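/- A \emph{product system} over a semigroup $P$ with identity $e$ is a family $p:E\to P$ of nontrivial complex Hilbert spaces $E_t=p^{-1}(t)$, with $\dim E_e=1$, such that $E$ is a semigroup, $p$ is a homomorphism, and for all $s,t\in P$ the map $(u,v)\in E_s\times E_t\mapsto uv\in E_{st}$ extends to a unitary isomorphism of $E_s\otimes E_t$ onto $E_{st}$. A \emph{representation} of $E$ on a Hilbert space $\mathcal H$ is a multiplicative map $\phi:E\to\mathcal B(\mathcal H)$ with $\phi(v)^*\phi(u)=\langle u,v\rangle I$ whenever $p(u)=p(v)$ (inner products being linear in the first variable). A \emph{twisted system} $(A,P,\beta,E)$ consists of a unital $C^*$-algebra $A$, an action $\beta$ of $P$ on $A$ by (not necessarily unital) $*$-endomorphisms, and a product system $E$ over $P$. A \emph{covariant representation} of it on a nonzero Hilbert space $\mathcal H$ is a pair $(\pi,\phi)$ of a unital representation $\pi$ of $A$ and a representation $\phi$ of $E$ on $\mathcal H$ such that $\pi(\beta_s(a))=\sum_{v\in\mathcal B}\phi(v)\pi(a)\phi(v)^*$ (strong convergence) for all $s\in P$, $a\in A$ and every orthonormal basis $\mathcal B$ of $E_s$. A \emph{crossed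 product} for $(A,P,\beta,E)$ is a triple $(B,i_A,i_E)$ of a unital $C^*$-algebra $B$, a unital $*$-homomorphism $i_A:A\to B$ and a map $i_E:E\to B$ such that (a) $B$ has a faithful unital representation $\sigma$ for which $(\sigma\circ i_A,\sigma\circ i_E)$ is covariant; (b) for every covariant representation $(\pi,\phi)$ there is a unital representation $\rho$ of $B$ with $\rho\circ i_A=\pi$ and $\rho\circ i_E=\phi$; (c) $B$ is generated as a $C^*$-algebra by $i_A(A)\cup i_E(E)$. For a discrete group $G$, let $C^*(G)$ be its full group $C^*$-algebra with canonical unitaries $i_G(g)$, and let $\delta_G:C^*(G)\to C^*(G)\otimes_{\min}C^*(G)$ be the homomorphism with $\delta_G(i_G(g))=i_G(g)\otimes i_G(g)$. A \emph{coaction} of $G$ on a unital $C^*$-algebra $B$ is a unital $*$-homomorphism $\delta:B\to B\otimes_{\min}C^*(G)$ such that $(\delta\otimes\mathrm{id})\circ\delta=(\mathrm{id}\otimes\delta_G)\circ\delta$ (up to the canonical identification of the triple tensor products) and $\delta(B)(1\otimes C^*(G))$ spans a dense subspace of $B\otimes_{\min}C^*(G)$. \textbf{Proposition.} Let $G$ be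 a discrete group, let $P\subseteq G$ be a subsemigroup containing the identity, and let $(A,P,\beta,E)$ be a twisted system which has a covariant representation. Then $(A,P,\beta,E)$ has a crossed product, and for every crossed product $(A\rtimes_{\beta,E}P,i_A,i_E)$ the following hold. (i) There is an injective coaction $\delta:A\rtimes_{\beta,E}P\to(A\rtimes_{\beta,E}P)\otimes_{\min}C^*(G)$ of $G$ such that $$\delta(i_A(a))=i_A(a)\otimes 1\quad\text{and}\quad\delta(i_E(v))=i_E(v)\otimes i_G(p(v))\qquad(a\in A,\ v\in E).$$ (ii) If $G$ is abelian, there is a strongly continuous action $\widehat\beta$ of the dual group $\widehat G$ by $*$-automorphisms of $A\rtimes_{\beta,E}P$ such that $$\widehat\beta_\gamma(i_A(a))=i_A(a)\quad\text{and}\quad\widehat\beta_\gamma(i_E(v))=\gamma(p(v))\,i_E(v)\qquad(\gamma\in\widehat G,\ a\in A,\ v\in E).$$ -/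

import Mathlib

open UniformSpace TensorProduct

universe u

noncomputable section

/-- A C⋆-seminorm on a complex ⋆-algebra. -/
structure CStarSeminorm (R : Type*) [Ring R] [StarRing R] [Algebra ℂ R] where
  toFun : R → ℝ
  add_le : ∀ x y, toFun (x + y) ≤ toFun x + toFun y
  smul_eq : ∀ (c : ℂ) x, toFun (c • x) = ‖c‖ * toFun x
  mul_le : ∀ x y, toFun (x * y) ≤ toFun x * toFun y
  star_eq : ∀ x, toFun (star x) = toFun x
  star_mul_self : ∀ x, toFun (star x * x) = toFun x * toFun x

namespace CStarSeminorm

section Completion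

variable {R : Type*} [Ring R] [StarRing R] [Algebra ℂ R] (p : CStarSeminorm R)

/-- The algebra `R`, regarded as a seminormed algebra under `p`. -/
@[nolint unusedArguments]
def Carrier (_p : CStarSeminorm R) : Type _ := R

instance : Ring p.Carrier := inferInstanceAs (Ring R)
instance : StarRing p.Carrier := inferInstanceAs (StarRing R)
instance : Algebra ℂ p.Carrier := inferInstanceAs (Algebra ℂ R)

/-- The seminorm of the additive group underlying `p`. -/
def addGroupSeminorm : AddGroupSeminorm p.Carrier where
  toFun := p.toFun
  map_zero' := by
    have h := p.smul_eq 0 (0 : R)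
    rwa [zero_smul, norm_zero, zero_mul] at h
  add_le' := p.add_le
  neg' x := by
    have h : p.toFun ((-1 : ℂ) • (show R from x)) = _ := p.smul_eq (-1) x
    rwa [neg_smul, one_smul, norm_neg, norm_one, one_mul] at h

instance : SeminormedAddCommGroup p.Carrier := p.addGroupSeminorm.toSeminormedAddCommGroup

instance : SeminormedRing p.Carrier where
  __ : SeminormedAddCommGroup p.Carrier := inferInstance
  __ : Ring p.Carrier := inferInstance
  norm_mul_le := p.mul_le

instance : NormedAlgebra ℂ p.Carrier where
  norm_smul_le c x := (p.smul_eq c x).le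

instance : NormedStarGroup p.Carrier where
  norm_star_le x := (p.star_eq x).le

/-- The C⋆-algebra obtained from `(R, p)` by separation and completion. -/
def Compl : Type _ := Completion p.Carrier

instance : NormedRing p.Compl := inferInstanceAs (NormedRing (Completion p.Carrier))
instance : CompleteSpace p.Compl := inferInstanceAs (CompleteSpace (Completion p.Carrier))
instance : Algebra ℂ p.Compl := inferInstanceAs (Algebra ℂ (Completion p.Carrier))
instance : NormedAlgebra ℂ p.Compl where
  norm_smul_le c x := by
    exact norm_smul_le (α := ℂ) (β := Completion p.Carrier) c x

/-- The canonical map of `R` into its completion. -/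
def coeFun (x : R) : p.Compl := ((show p.Carrier from x : p.Carrier) : Completion p.Carrier)

theorem norm_coeFun (x : R) : ‖p.coeFun x‖ = p.toFun x := Completion.norm_coe (E := p.Carrier) x

theorem denseRange_coeFun : DenseRange p.coeFun := Completion.denseRange_coe (α := p.Carrier)

theorem isClosed_induction {C : p.Compl → Prop} (hC : IsClosed {a | C a})
    (h : ∀ x : R, C (p.coeFun x)) (a : p.Compl) : C a :=
  Completion.induction_on (α := p.Carrier) (p := C) a hC h

theorem coeFun_add (x y : R) : p.coeFun (x + y) = p.coeFun x + p.coeFun y :=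
  Completion.coe_add (α := p.Carrier) x y

theorem coeFun_mul (x y : R) : p.coeFun (x * y) = p.coeFun x * p.coeFun y :=
  Completion.coe_mul (α := p.Carrier) x y

theorem coeFun_one : p.coeFun 1 = 1 := rfl

theorem coeFun_zero : p.coeFun 0 = 0 := rfl

theorem coeFun_smul (c : ℂ) (x : R) : p.coeFun (c • x) = c • p.coeFun x :=
  Completion.coe_smul (X := p.Carrier) c x

instance : Star p.Compl := ⟨Completion.map (star : p.Carrier → p.Carrier)⟩

theorem star_uniformContinuous : UniformContinuous (star : p.Carrier → p.Carrier) :=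
  (starNormedAddGroupHom : NormedAddGroupHom p.Carrier p.Carrier).uniformContinuous

theorem continuous_star' : Continuous (star : p.Compl → p.Compl) :=
  Completion.continuous_map

theorem coeFun_star (x : R) : p.coeFun (star x) = star (p.coeFun x) :=
  (Completion.map_coe p.star_uniformContinuous x).symm

instance : StarRing p.Compl where
  star_involutive a := by
    refine p.isClosed_induction (C := fun a => star (star a) = a) ?_ ?_ a
    · exact isClosed_eq (p.continuous_star'.comp p.continuous_star') continuous_id
    · intro x; simp [← coeFun_star]
  star_mul a b := by
    have h2 := p.continuous_star'
    refine p.isClosed_induction (C := fun a => star (a * b) = star b * star a) ?_ ?_ a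
    · exact isClosed_eq (by fun_prop) (by fun_prop)
    intro x
    refine p.isClosed_induction (C := fun b => star (_ * b) = star b * star _) ?_ ?_ b
    · exact isClosed_eq (by fun_prop) (by fun_prop)
    intro y
    simp [← coeFun_star, ← coeFun_mul]
  star_add a b := by
    have h2 := p.continuous_star'
    refine p.isClosed_induction (C := fun a => star (a + b) = star a + star b) ?_ ?_ a
    · exact isClosed_eq (by fun_prop) (by fun_prop)
    intro x
    refine p.isClosed_induction (C := fun b => star (_ + b) = star _ + star b) ?_ ?_ b
    · exact isClosed_eq (by fun_prop) (by fun_prop)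
    intro y
    simp [← coeFun_star, ← coeFun_add]

/-- The canonical ⋆-homomorphism of `R` into its completion. -/
def coe : R →⋆ₐ[ℂ] p.Compl where
  toFun := p.coeFun
  map_one' := rfl
  map_zero' := rfl
  map_mul' := p.coeFun_mul
  map_add' := p.coeFun_add
  commutes' _ := rfl
  map_star' := p.coeFun_star

theorem norm_coe (x : R) : ‖p.coe x‖ = p.toFun x := p.norm_coeFun x

theorem nonneg (x : R) : 0 ≤ p.toFun x := (norm_nonneg (p.coe x)).trans_eq (p.norm_coe x)

theorem denseRange_coe : DenseRange p.coe := p.denseRange_coeFun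

/-- A ⋆-homomorphism on `R`, as a ring homomorphism on the seminormed algebra. -/
def ringHom {D : Type*} [CStarAlgebra D] (f : R →⋆ₐ[ℂ] D) : p.Carrier →+* D :=
  (f.toAlgHom.toRingHom : R →+* D)

theorem continuous_ringHom {D : Type*} [CStarAlgebra D] (f : R →⋆ₐ[ℂ] D)
    (hf : ∀ x, ‖f x‖ ≤ p.toFun x) : Continuous (p.ringHom f) :=
  AddMonoidHomClass.continuous_of_bound (p.ringHom f) 1 fun x =>
    (hf x).trans (le_of_eq (one_mul _).symm)

/-- A ⋆-homomorphism on `R` that is dominated by `p` extends to the completion. -/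
def lift {D : Type*} [CStarAlgebra D] (f : R →⋆ₐ[ℂ] D) (hf : ∀ x, ‖f x‖ ≤ p.toFun x) :
    p.Compl →⋆ₐ[ℂ] D :=
  let g := p.ringHom f
  have hg : Continuous g := p.continuous_ringHom f hf
  let F : Completion p.Carrier →+* D := Completion.extensionHom g hg
  have hF : ∀ x : R, F (p.coeFun x) = f x := fun x => Completion.extensionHom_coe g hg x
  have hFc : Continuous (F : p.Compl → D) := Completion.continuous_extension
  { toFun := F
    map_one' := F.map_one
    map_zero' := F.map_zero
    map_mul' := F.map_mul
    map_add' := F.map_add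
    commutes' := fun c => by
      have h := hF (algebraMap ℂ R c)
      rw [AlgHomClass.commutes f] at h
      exact h
    map_star' := fun a => by
      have h2 := p.continuous_star'
      refine p.isClosed_induction (C := fun a : p.Compl => F (star a : p.Compl) = star (F a)) ?_ ?_ a
      · exact isClosed_eq (hFc.comp h2) (continuous_star.comp hFc)
      intro x
      exact (congrArg F (p.coeFun_star x)).symm.trans
        ((hF _).trans ((map_star f x).trans (congrArg star (hF x).symm))) }

theorem lift_coe {D : Type*} [CStarAlgebra D] (f : R →⋆ₐ[ℂ] D) (hf : ∀ x, ‖f x‖ ≤ p.toFun x)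
    (x : R) : p.lift f hf (p.coe x) = f x := by
  exact Completion.extensionHom_coe _ (p.continuous_ringHom f hf) x

variable [StarModule ℂ R]

instance : StarModule ℂ p.Compl where
  star_smul c a := by
    have h2 := p.continuous_star'
    refine p.isClosed_induction (C := fun a => star (c • a) = star c • star a) ?_ ?_ a
    · exact isClosed_eq (h2.comp (continuous_const_smul c))
        ((continuous_const_smul (star c)).comp h2)
    intro x
    rw [← coeFun_star, ← coeFun_smul, ← coeFun_smul, ← coeFun_star, star_smul]

instance : CStarAlgebra p.Compl where
  norm_mul_self_le a := by
    have h2 := p.continuous_star'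
    refine p.isClosed_induction (C := fun a => ‖a‖ * ‖a‖ ≤ ‖star a * a‖) ?_ ?_ a
    · exact isClosed_le (by fun_prop) (by fun_prop)
    intro x
    rw [← coeFun_star, ← coeFun_mul, norm_coeFun, norm_coeFun, p.star_mul_self]

end Completion

/-- The supremum of the seminorms `x ↦ ‖π i x‖` of a pointwise bounded family of ⋆-homomorphisms. -/
def ofFamily {R : Type*} [Ring R] [StarRing R] [Algebra ℂ R] {ι : Type*} {D : ι → Type*}
    [∀ i, CStarAlgebra (D i)] (π : ∀ i, R →⋆ₐ[ℂ] D i)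
    (hb : ∀ x, BddAbove (Set.range fun i => ‖π i x‖)) : CStarSeminorm R where
  toFun x := ⨆ i, ‖π i x‖
  add_le x y := by
    refine Real.iSup_le (fun i => ?_) (add_nonneg (Real.iSup_nonneg fun _ => norm_nonneg _)
      (Real.iSup_nonneg fun _ => norm_nonneg _))
    rw [map_add]
    exact (norm_add_le _ _).trans (add_le_add (le_ciSup (hb x) i) (le_ciSup (hb y) i))
  smul_eq c x := by
    simp_rw [map_smul, norm_smul]
    exact (Real.mul_iSup_of_nonneg (norm_nonneg c) _).symm
  mul_le x y := by
    refine Real.iSup_le (fun i => ?_) (mul_nonneg (Real.iSup_nonneg fun _ => norm_nonneg _)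
      (Real.iSup_nonneg fun _ => norm_nonneg _))
    rw [map_mul]
    exact (norm_mul_le _ _).trans (mul_le_mul (le_ciSup (hb x) i) (le_ciSup (hb y) i)
      (norm_nonneg _) (Real.iSup_nonneg fun _ => norm_nonneg _))
  star_eq x := by simp_rw [map_star, norm_star]
  star_mul_self x := by
    have h0 : 0 ≤ ⨆ i, ‖π i x‖ := Real.iSup_nonneg fun _ => norm_nonneg _
    have h1 : ∀ i, ‖π i (star x * x)‖ = ‖π i x‖ * ‖π i x‖ := fun i => by
      rw [map_mul, map_star, CStarRing.norm_star_mul_self]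
    apply le_antisymm
    · refine Real.iSup_le (fun i => ?_) (mul_nonneg h0 h0)
      rw [h1]
      exact mul_self_le_mul_self (norm_nonneg _) (le_ciSup (hb x) i)
    · have h2 : (⨆ i, ‖π i x‖) ≤ Real.sqrt (⨆ i, ‖π i (star x * x)‖) := by
        refine Real.iSup_le (fun i => ?_) (Real.sqrt_nonneg _)
        apply Real.le_sqrt_of_sq_le
        rw [sq, ← h1]
        exact le_ciSup (hb _) i
      calc _ ≤ _ := mul_self_le_mul_self h0 h2
        _ = _ := Real.mul_self_sqrt (Real.iSup_nonneg fun _ => norm_nonneg _)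

end CStarSeminorm

/-! ### The full group C⋆-algebra -/

section GroupAlgebra

variable {G : Type u} [Group G]

/-- The involution of the group algebra: `(∑ c_g g)⋆ = ∑ conj(c_g) g⁻¹`. -/
instance : Star (MonoidAlgebra ℂ G) where
  star x := x.coeff.sum fun g c => MonoidAlgebra.single g⁻¹ (star c)

theorem MonoidAlgebra.star_single' (g : G) (c : ℂ) :
    star (MonoidAlgebra.single g c) = MonoidAlgebra.single g⁻¹ (star c) := by
  change Finsupp.sum _ _ = _
  rw [MonoidAlgebra.coeff_single, Finsupp.sum_single_index (by simp)]

theorem MonoidAlgebra.star_add' (x y : MonoidAlgebra ℂ G) : star (x + y) = star x + star y := by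
  change Finsupp.sum _ _ = Finsupp.sum _ _ + Finsupp.sum _ _
  rw [MonoidAlgebra.coeff_add]
  exact Finsupp.sum_add_index' (by simp) (by simp)

theorem MonoidAlgebra.star_zero' : star (0 : MonoidAlgebra ℂ G) = 0 := by
  change Finsupp.sum _ _ = _
  simp

instance : StarRing (MonoidAlgebra ℂ G) where
  star_involutive x := by
    induction x using MonoidAlgebra.induction_linear with
    | zero => simp [MonoidAlgebra.star_zero']
    | add x y hx hy => rw [MonoidAlgebra.star_add', MonoidAlgebra.star_add', hx, hy]
    | single g c => simp [MonoidAlgebra.star_single']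
  star_add := MonoidAlgebra.star_add'
  star_mul x y := by
    induction x using MonoidAlgebra.induction_linear with
    | zero => simp [MonoidAlgebra.star_zero']
    | add x x' hx hx' =>
      rw [add_mul, MonoidAlgebra.star_add', MonoidAlgebra.star_add', hx, hx', mul_add]
    | single g c =>
      induction y using MonoidAlgebra.induction_linear with
      | zero => simp [MonoidAlgebra.star_zero']
      | add y y' hy hy' =>
        rw [mul_add, MonoidAlgebra.star_add', MonoidAlgebra.star_add', hy, hy', add_mul]
      | single h d => simp [MonoidAlgebra.star_single', MonoidAlgebra.single_mul_single, mul_comm]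

instance : StarModule ℂ (MonoidAlgebra ℂ G) where
  star_smul c x := by
    induction x using MonoidAlgebra.induction_linear with
    | zero => simp
    | add x y hx hy => rw [smul_add, star_add, hx, hy, star_add, smul_add]
    | single g d => simp [MonoidAlgebra.star_single']

/-- The integrated form of a homomorphism of `G` into the unitary group of a C⋆-algebra. -/
def integratedForm {D : Type*} [CStarAlgebra D] (U : G →* unitary D) :
    MonoidAlgebra ℂ G →⋆ₐ[ℂ] D where
  __ := MonoidAlgebra.lift ℂ D G ((unitary D).subtype.comp U)
  map_star' x := by
    change MonoidAlgebra.lift ℂ D G _ _ = star (MonoidAlgebra.lift ℂ D G _ _)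
    induction x using MonoidAlgebra.induction_linear with
    | zero => simp
    | add x y hx hy => rw [star_add, map_add, hx, hy, map_add, star_add]
    | single g c =>
      rw [MonoidAlgebra.star_single', MonoidAlgebra.lift_single, MonoidAlgebra.lift_single,
        star_smul]
      simp [← Unitary.star_eq_inv]

theorem integratedForm_single {D : Type*} [CStarAlgebra D] (U : G →* unitary D) (g : G) (c : ℂ) :
    integratedForm U (MonoidAlgebra.single g c) = c • (U g : D) :=
  MonoidAlgebra.lift_single _ _ _

theorem norm_integratedForm_le {D : Type*} [CStarAlgebra D] (U : G →* unitary D)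
    (x : MonoidAlgebra ℂ G) : ‖integratedForm U x‖ ≤ x.coeff.sum fun _ c => ‖c‖ := by
  have h : integratedForm U x = x.coeff.sum fun g c => c • (U g : D) := by
    change MonoidAlgebra.lift ℂ D G _ _ = _
    rw [MonoidAlgebra.lift_apply]
    rfl
  rw [h]
  refine (norm_sum_le _ _).trans (Finset.sum_le_sum fun g _ => ?_)
  rw [norm_smul]
  rcases subsingleton_or_nontrivial D with hD | hD
  · simp [Subsingleton.elim (U g : D) 0]
  · rw [CStarRing.norm_coe_unitary, mul_one]

variable (G) in
/-- A unitary representation of `G` on a Hilbert space. -/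
structure UnitaryRep where
  H : Type u
  [normedAddCommGroup : NormedAddCommGroup H]
  [innerProductSpace : InnerProductSpace ℂ H]
  [completeSpace : CompleteSpace H]
  U : G →* unitary (H →L[ℂ] H)

attribute [instance] UnitaryRep.normedAddCommGroup UnitaryRep.innerProductSpace
  UnitaryRep.completeSpace

variable (G) in
/-- The full C⋆-norm on the group algebra: the supremum of `‖π_U(x)‖` over all unitary
representations `U` of `G`. -/
def groupSeminorm : CStarSeminorm (MonoidAlgebra ℂ G) :=
  CStarSeminorm.ofFamily (ι := UnitaryRep G) (fun U => integratedForm U.U) fun x =>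
    ⟨_, Set.forall_mem_range.2 fun U => norm_integratedForm_le U.U x⟩

variable (G) in
/-- The full group C⋆-algebra of the discrete group `G`: the completion of the group
algebra in the full C⋆-norm. -/
abbrev GroupCStar : Type u := (groupSeminorm G).Compl

/-- The canonical element of the group C⋆-algebra attached to a group element. -/
def iG (g : G) : GroupCStar G := (groupSeminorm G).coe (MonoidAlgebra.single g 1)

theorem iG_one : iG (1 : G) = 1 := map_one (groupSeminorm G).coe

theorem iG_mul (g h : G) : iG (g * h) = iG g * iG h := by
  rw [iG, iG, iG, ← map_mul, MonoidAlgebra.single_mul_single, one_mul]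

theorem star_iG (g : G) : star (iG g) = iG g⁻¹ := by
  rw [iG, iG, ← map_star, MonoidAlgebra.star_single', star_one]

end GroupAlgebra

/-! ### The minimal tensor product of unital C⋆-algebras -/

section MinTensor

section Hilbert

variable (H K : Type*) [NormedAddCommGroup H] [InnerProductSpace ℂ H]
  [NormedAddCommGroup K] [InnerProductSpace ℂ K]

/-- The Hilbert space tensor product: the completion of the algebraic tensor product. -/
def HilbertTensor : Type _ := Completion (H ⊗[ℂ] K)

instance : NormedAddCommGroup (HilbertTensor H K) :=
  inferInstanceAs (NormedAddCommGroup (Completion (H ⊗[ℂ] K)))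

instance : InnerProductSpace ℂ (HilbertTensor H K) :=
  inferInstanceAs (InnerProductSpace ℂ (Completion (H ⊗[ℂ] K)))

instance : CompleteSpace (HilbertTensor H K) :=
  inferInstanceAs (CompleteSpace (Completion (H ⊗[ℂ] K)))

variable {H K}

/-- The inclusion of the algebraic tensor product into the Hilbert space tensor product. -/
def toHilbertTensor : H ⊗[ℂ] K →ₗᵢ[ℂ] HilbertTensor H K :=
  Completion.toComplₗᵢ (𝕜 := ℂ) (E := H ⊗[ℂ] K)

/-- The operator `S ⊗ T` on the Hilbert space tensor product. -/
def opTensor (S : H →L[ℂ] H) (T : K →L[ℂ] K) : HilbertTensor H K →L[ℂ] HilbertTensor H K :=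
  (TensorProduct.mapL S T).completion

theorem opTensor_coe (S : H →L[ℂ] H) (T : K →L[ℂ] K) (x : H ⊗[ℂ] K) :
    opTensor S T (toHilbertTensor x) = toHilbertTensor (TensorProduct.mapL S T x) :=
  ContinuousLinearMap.completion_apply_coe _ _

theorem hilbertTensor_induction {p : HilbertTensor H K → Prop} (hp : IsClosed {a | p a})
    (h : ∀ x : H ⊗[ℂ] K, p (toHilbertTensor x)) (a : HilbertTensor H K) : p a :=
  Completion.induction_on (α := H ⊗[ℂ] K) (p := p) a hp h

theorem hilbertTensor_ext {S T : HilbertTensor H K →L[ℂ] HilbertTensor H K}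
    (h : ∀ x : H ⊗[ℂ] K, S (toHilbertTensor x) = T (toHilbertTensor x)) : S = T := by
  ext a
  refine hilbertTensor_induction (p := fun a => S a = T a) ?_ h a
  exact isClosed_eq (by fun_prop) (by fun_prop)

theorem norm_opTensor_le (S : H →L[ℂ] H) (T : K →L[ℂ] K) : ‖opTensor S T‖ ≤ ‖S‖ * ‖T‖ := by
  refine ContinuousLinearMap.opNorm_le_bound _ (by positivity) fun a => ?_
  refine hilbertTensor_induction
    (p := fun a => ‖opTensor S T a‖ ≤ ‖S‖ * ‖T‖ * ‖a‖) ?_ (fun x => ?_) a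
  · exact isClosed_le (by fun_prop) (by fun_prop)
  · rw [opTensor_coe, LinearIsometry.norm_map, LinearIsometry.norm_map]
    exact (ContinuousLinearMap.le_opNorm _ _).trans
      (mul_le_mul_of_nonneg_right (TensorProduct.norm_mapL_le S T) (norm_nonneg _))

theorem opTensor_add_left (S S' : H →L[ℂ] H) (T : K →L[ℂ] K) :
    opTensor (S + S') T = opTensor S T + opTensor S' T :=
  hilbertTensor_ext fun x => by
    rw [add_apply, opTensor_coe, opTensor_coe, opTensor_coe,
      TensorProduct.mapL_add_left, add_apply, map_add]

theorem opTensor_add_right (S : H →L[ℂ] H) (T T' : K →L[ℂ] K) :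
    opTensor S (T + T') = opTensor S T + opTensor S T' :=
  hilbertTensor_ext fun x => by
    rw [add_apply, opTensor_coe, opTensor_coe, opTensor_coe,
      TensorProduct.mapL_add_right, add_apply, map_add]

theorem opTensor_smul_left (c : ℂ) (S : H →L[ℂ] H) (T : K →L[ℂ] K) :
    opTensor (c • S) T = c • opTensor S T :=
  hilbertTensor_ext fun x => by
    rw [smul_apply, opTensor_coe, opTensor_coe,
      TensorProduct.mapL_smul_left, smul_apply, map_smul]

theorem opTensor_smul_right (c : ℂ) (S : H →L[ℂ] H) (T : K →L[ℂ] K) :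
    opTensor S (c • T) = c • opTensor S T :=
  hilbertTensor_ext fun x => by
    rw [smul_apply, opTensor_coe, opTensor_coe,
      TensorProduct.mapL_smul_right, smul_apply, map_smul]

theorem opTensor_mul (S S' : H →L[ℂ] H) (T T' : K →L[ℂ] K) :
    opTensor (S * S') (T * T') = opTensor S T * opTensor S' T' :=
  hilbertTensor_ext fun x => by
    rw [mul_apply_eq_comp, opTensor_coe, opTensor_coe, opTensor_coe,
      TensorProduct.mapL_mul, mul_apply_eq_comp]

theorem opTensor_one : opTensor (1 : H →L[ℂ] H) (1 : K →L[ℂ] K) = 1 :=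
  hilbertTensor_ext fun x => by
    rw [opTensor_coe, one_apply_eq_self]
    exact congrArg _ (congrArg (fun f : (H ⊗[ℂ] K) →L[ℂ] (H ⊗[ℂ] K) => f x)
      TensorProduct.mapL_id_id)

end Hilbert

section Adjoint

variable {H K : Type*} [NormedAddCommGroup H] [InnerProductSpace ℂ H] [CompleteSpace H]
  [NormedAddCommGroup K] [InnerProductSpace ℂ K] [CompleteSpace K]

theorem mapL_inner (S : H →L[ℂ] H) (T : K →L[ℂ] K) (x y : H ⊗[ℂ] K) :
    inner ℂ (TensorProduct.mapL (star S) (star T) x) y = inner ℂ x (TensorProduct.mapL S T y) := by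
  induction x using TensorProduct.induction_on with
  | zero => simp
  | add x x' hx hx' => rw [map_add, inner_add_left, inner_add_left, hx, hx']
  | tmul a b =>
    induction y using TensorProduct.induction_on with
    | zero => simp
    | add y y' hy hy' => rw [map_add, inner_add_right, inner_add_right, hy, hy']
    | tmul c d =>
      simp [ContinuousLinearMap.star_eq_adjoint, ContinuousLinearMap.adjoint_inner_left]

theorem opTensor_star (S : H →L[ℂ] H) (T : K →L[ℂ] K) :
    opTensor (star S) (star T) = star (opTensor S T) := by
  rw [ContinuousLinearMap.star_eq_adjoint (opTensor S T)]
  refine (ContinuousLinearMap.eq_adjoint_iff _ _).mpr fun a b => ?_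
  refine hilbertTensor_induction
    (p := fun a => inner ℂ (opTensor (star S) (star T) a) b = inner ℂ a (opTensor S T b))
    (isClosed_eq (by fun_prop) (by fun_prop)) (fun x => ?_) a
  refine hilbertTensor_induction
    (p := fun b => inner ℂ (opTensor (star S) (star T) (toHilbertTensor x)) b =
      inner ℂ (toHilbertTensor x) (opTensor S T b))
    (isClosed_eq (by fun_prop) (by fun_prop)) (fun y => ?_) b
  rw [opTensor_coe, opTensor_coe, LinearIsometry.inner_map_map, LinearIsometry.inner_map_map,
    mapL_inner]

end Adjoint

variable {B C : Type u} [CStarAlgebra B] [CStarAlgebra C]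

/-- The tensor product `σ ⊗ π` of two representations, on the algebraic tensor product. -/
def repTensor {H K : Type*} [NormedAddCommGroup H] [InnerProductSpace ℂ H] [CompleteSpace H]
    [NormedAddCommGroup K] [InnerProductSpace ℂ K] [CompleteSpace K]
    (σ : B →⋆ₐ[ℂ] (H →L[ℂ] H)) (π : C →⋆ₐ[ℂ] (K →L[ℂ] K)) :
    B ⊗[ℂ] C →⋆ₐ[ℂ] (HilbertTensor H K →L[ℂ] HilbertTensor H K) :=
  let L : B ⊗[ℂ] C →ₗ[ℂ] (HilbertTensor H K →L[ℂ] HilbertTensor H K) :=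
    TensorProduct.lift (LinearMap.mk₂ ℂ (fun b c => opTensor (σ b) (π c))
      (fun b b' c => by rw [map_add, opTensor_add_left])
      (fun r b c => by rw [map_smul, opTensor_smul_left])
      (fun b c c' => by rw [map_add, opTensor_add_right])
      (fun r b c => by rw [map_smul, opTensor_smul_right]))
  { Algebra.TensorProduct.algHomOfLinearMapTensorProduct L
      (fun b b' c c' => by
        change opTensor _ _ = opTensor _ _ * opTensor _ _
        rw [map_mul, map_mul, opTensor_mul])
      (by
        change opTensor _ _ = _
        rw [map_one, map_one, opTensor_one]) with
    map_star' := fun x => by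
      change L (star x) = star (L x)
      induction x using TensorProduct.induction_on with
      | zero => simp
      | add x y hx hy => rw [star_add, map_add, hx, hy, map_add, star_add]
      | tmul b c =>
        change opTensor (σ (star b)) (π (star c)) = star (opTensor (σ b) (π c))
        rw [map_star, map_star, opTensor_star] }

theorem repTensor_tmul {H K : Type*} [NormedAddCommGroup H] [InnerProductSpace ℂ H]
    [CompleteSpace H] [NormedAddCommGroup K] [InnerProductSpace ℂ K] [CompleteSpace K]
    (σ : B →⋆ₐ[ℂ] (H →L[ℂ] H)) (π : C →⋆ₐ[ℂ] (K →L[ℂ] K)) (b : B) (c : C) :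
    repTensor σ π (b ⊗ₜ c) = opTensor (σ b) (π c) := rfl

theorem exists_bound_repTensor (x : B ⊗[ℂ] C) : ∃ M : ℝ, ∀ (H K : Type u) [NormedAddCommGroup H]
    [InnerProductSpace ℂ H] [CompleteSpace H] [NormedAddCommGroup K] [InnerProductSpace ℂ K]
    [CompleteSpace K] (σ : B →⋆ₐ[ℂ] (H →L[ℂ] H)) (π : C →⋆ₐ[ℂ] (K →L[ℂ] K)),
    ‖repTensor σ π x‖ ≤ M := by
  induction x using TensorProduct.induction_on with
  | zero => exact ⟨0, by intros; simp⟩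
  | add x y hx hy =>
    obtain ⟨M, hM⟩ := hx
    obtain ⟨N, hN⟩ := hy
    refine ⟨M + N, ?_⟩
    intros
    rw [map_add]
    exact (norm_add_le _ _).trans (add_le_add (hM _ _ _ _) (hN _ _ _ _))
  | tmul b c =>
    refine ⟨‖b‖ * ‖c‖, ?_⟩
    intro H K _ _ _ _ _ _ σ π
    have h1 : ‖σ b‖ ≤ ‖b‖ := NonUnitalStarAlgHom.norm_apply_le σ b
    have h2 : ‖π c‖ ≤ ‖c‖ := NonUnitalStarAlgHom.norm_apply_le π c
    rw [repTensor_tmul]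
    exact (norm_opTensor_le _ _).trans (mul_le_mul h1 h2 (norm_nonneg _) (norm_nonneg _))

variable (B) in
/-- A (unital) representation of the C⋆-algebra `B` on a Hilbert space. -/
structure CStarRep where
  H : Type u
  [normedAddCommGroup : NormedAddCommGroup H]
  [innerProductSpace : InnerProductSpace ℂ H]
  [completeSpace : CompleteSpace H]
  π : B →⋆ₐ[ℂ] (H →L[ℂ] H)

attribute [instance] CStarRep.normedAddCommGroup CStarRep.innerProductSpace
  CStarRep.completeSpace

variable (B C) in
/-- The minimal (spatial) C⋆-norm on the algebraic tensor product: the supremum of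
`‖(σ ⊗ π)(x)‖` over all representations `σ` of `B` and `π` of `C`. -/
def minSeminorm : CStarSeminorm (B ⊗[ℂ] C) :=
  CStarSeminorm.ofFamily (ι := CStarRep B × CStarRep C) (fun i => repTensor i.1.π i.2.π) fun x =>
    (exists_bound_repTensor x).imp fun _ hM =>
      Set.forall_mem_range.2 fun i => hM i.1.H i.2.H i.1.π i.2.π

variable (B C) in
/-- The minimal tensor product of unital C⋆-algebras. -/
abbrev MinTensor : Type u := (minSeminorm B C).Compl

/-- The elementary tensor `b ⊗ c`. -/
def tensor (b : B) (c : C) : MinTensor B C := (minSeminorm B C).coe (b ⊗ₜ c)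

end MinTensor

section Functoriality

variable {B B' C C' : Type u} [CStarAlgebra B] [CStarAlgebra B'] [CStarAlgebra C] [CStarAlgebra C']

theorem tensor_mul (b b' : B) (c c' : C) :
    tensor (b * b') (c * c') = tensor b c * tensor b' c' := by
  rw [tensor, tensor, tensor, ← map_mul, Algebra.TensorProduct.tmul_mul_tmul]

theorem tensor_one : tensor (1 : B) (1 : C) = 1 := map_one (minSeminorm B C).coe

theorem star_tensor (b : B) (c : C) : star (tensor b c) = tensor (star b) (star c) := by
  rw [tensor, tensor, ← map_star, TensorProduct.star_tmul]

theorem repTensor_le (σ : CStarRep B) (π : CStarRep C) (x : B ⊗[ℂ] C) :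
    ‖repTensor σ.π π.π x‖ ≤ (minSeminorm B C).toFun x :=
  le_ciSup (f := fun i : CStarRep B × CStarRep C => ‖repTensor i.1.π i.2.π x‖)
    ((exists_bound_repTensor x).imp fun _ hM =>
      Set.forall_mem_range.2 fun i => hM i.1.H i.2.H i.1.π i.2.π) (σ, π)

/-- The representation `σ ⊗ π` of the minimal tensor product. -/
def minTensorRep (σ : CStarRep B) (π : CStarRep C) :
    MinTensor B C →⋆ₐ[ℂ] (HilbertTensor σ.H π.H →L[ℂ] HilbertTensor σ.H π.H) :=
  (minSeminorm B C).lift (repTensor σ.π π.π) (repTensor_le σ π)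

/-- The algebraic tensor product of two ⋆-homomorphisms. -/
def algTensorMap (f : B →⋆ₐ[ℂ] B') (g : C →⋆ₐ[ℂ] C') : B ⊗[ℂ] C →⋆ₐ[ℂ] B' ⊗[ℂ] C' where
  __ := Algebra.TensorProduct.map f.toAlgHom g.toAlgHom
  map_star' x := by
    change Algebra.TensorProduct.map f.toAlgHom g.toAlgHom (star x) =
      star (Algebra.TensorProduct.map f.toAlgHom g.toAlgHom x)
    induction x using TensorProduct.induction_on with
    | zero => simp
    | add x y hx hy => rw [star_add, map_add, hx, hy, map_add, star_add]
    | tmul b c =>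
      change f (star b) ⊗ₜ[ℂ] g (star c) = star (f b ⊗ₜ[ℂ] g c)
      rw [map_star, map_star, TensorProduct.star_tmul]

theorem algTensorMap_le (f : B →⋆ₐ[ℂ] B') (g : C →⋆ₐ[ℂ] C') (x : B ⊗[ℂ] C) :
    ‖(minSeminorm B' C').coe (algTensorMap f g x)‖ ≤ (minSeminorm B C).toFun x := by
  rw [CStarSeminorm.norm_coe]
  refine Real.iSup_le (fun i => ?_) (Real.iSup_nonneg fun _ => norm_nonneg _)
  have h : repTensor i.1.π i.2.π (algTensorMap f g x) =
      repTensor (i.1.π.comp f) (i.2.π.comp g) x := by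
    induction x using TensorProduct.induction_on with
    | zero => rw [map_zero, map_zero, map_zero]
    | add x y hx hy => rw [map_add, map_add, map_add, hx, hy]
    | tmul b c => rfl
  rw [h]
  exact repTensor_le ⟨i.1.H, i.1.π.comp f⟩ ⟨i.2.H, i.2.π.comp g⟩ x

/-- The ⋆-homomorphism `f ⊗ g` between minimal tensor products. -/
def minTensorMap (f : B →⋆ₐ[ℂ] B') (g : C →⋆ₐ[ℂ] C') : MinTensor B C →⋆ₐ[ℂ] MinTensor B' C' :=
  (minSeminorm B C).lift ((minSeminorm B' C').coe.comp (algTensorMap f g)) (algTensorMap_le f g)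

theorem minTensorMap_tensor (f : B →⋆ₐ[ℂ] B') (g : C →⋆ₐ[ℂ] C') (b : B) (c : C) :
    minTensorMap f g (tensor b c) = tensor (f b) (g c) :=
  CStarSeminorm.lift_coe _ _ (algTensorMap_le f g) _

end Functoriality

/-! ### The comultiplication and coactions -/

section Coaction

variable (G : Type u) [Group G]

/-- The unitaries `i_G(g) ⊗ i_G(g)`. -/
def diagonalUnitary : G →* unitary (MinTensor (GroupCStar G) (GroupCStar G)) where
  toFun g := ⟨tensor (iG g) (iG g), by
    rw [Unitary.mem_iff, star_tensor, ← tensor_mul, ← tensor_mul, star_iG, ← iG_mul, ← iG_mul,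
      inv_mul_cancel, mul_inv_cancel, iG_one, tensor_one]
    exact ⟨rfl, rfl⟩⟩
  map_one' := by
    ext
    change tensor (iG 1) (iG 1) = 1
    rw [iG_one, tensor_one]
  map_mul' g h := by
    ext
    change tensor (iG (g * h)) (iG (g * h)) = tensor (iG g) (iG g) * tensor (iG h) (iG h)
    rw [iG_mul, tensor_mul]

variable {G}

theorem integratedForm_le (U : UnitaryRep G) (x : MonoidAlgebra ℂ G) :
    ‖integratedForm U.U x‖ ≤ (groupSeminorm G).toFun x :=
  le_ciSup (f := fun U : UnitaryRep G => ‖integratedForm U.U x‖)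
    ⟨_, Set.forall_mem_range.2 fun U => norm_integratedForm_le U.U x⟩ U

/-- The unitary representation `f ∘ U`. -/
def mapUnitary {D D' : Type*} [CStarAlgebra D] [CStarAlgebra D'] (f : D →⋆ₐ[ℂ] D')
    (U : G →* unitary D) : G →* unitary D' where
  toFun g := ⟨f (U g), by
    rw [Unitary.mem_iff, ← map_star, ← map_mul, ← map_mul,
      Unitary.star_mul_self_of_mem (U g).2, Unitary.mul_star_self_of_mem (U g).2, map_one]
    exact ⟨rfl, rfl⟩⟩
  map_one' := by
    ext
    change f (U 1 : D) = 1
    rw [map_one, OneMemClass.coe_one, map_one]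
  map_mul' g h := by
    ext
    change f (U (g * h) : D) = f (U g : D) * f (U h : D)
    rw [map_mul, Submonoid.coe_mul, map_mul]

theorem integratedForm_mapUnitary {D D' : Type*} [CStarAlgebra D] [CStarAlgebra D']
    (f : D →⋆ₐ[ℂ] D') (U : G →* unitary D) (x : MonoidAlgebra ℂ G) :
    f (integratedForm U x) = integratedForm (mapUnitary f U) x := by
  induction x using MonoidAlgebra.induction_linear with
  | zero => rw [map_zero, map_zero, map_zero]
  | add x y hx hy => rw [map_add, map_add, map_add, hx, hy]
  | single g c => rw [integratedForm_single, integratedForm_single, map_smul]; rfl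

theorem exists_diagonal (x : MonoidAlgebra ℂ G) :
    ∃ y : GroupCStar G ⊗[ℂ] GroupCStar G, (minSeminorm (GroupCStar G) (GroupCStar G)).coe y =
      integratedForm (diagonalUnitary G) x := by
  induction x using MonoidAlgebra.induction_linear with
  | zero => exact ⟨0, by rw [map_zero, map_zero]⟩
  | add x x' hx hx' =>
    obtain ⟨y, hy⟩ := hx
    obtain ⟨y', hy'⟩ := hx'
    exact ⟨y + y', by rw [map_add, map_add, hy, hy']⟩
  | single g c =>
    refine ⟨c • (iG g ⊗ₜ iG g), ?_⟩
    rw [integratedForm_single, map_smul]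
    rfl

theorem minTensorRep_coe {B C : Type u} [CStarAlgebra B] [CStarAlgebra C] (σ : CStarRep B)
    (π : CStarRep C) (y : B ⊗[ℂ] C) :
    minTensorRep σ π ((minSeminorm B C).coe y) = repTensor σ.π π.π y :=
  CStarSeminorm.lift_coe _ _ (repTensor_le σ π) y

theorem norm_minTensor_le {B C : Type u} [CStarAlgebra B] [CStarAlgebra C] (y : B ⊗[ℂ] C) {M : ℝ}
    (hM : 0 ≤ M)
    (h : ∀ (σ : CStarRep B) (π : CStarRep C),
      ‖minTensorRep σ π ((minSeminorm B C).coe y)‖ ≤ M) :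
    ‖(minSeminorm B C).coe y‖ ≤ M := by
  rw [CStarSeminorm.norm_coe]
  refine Real.iSup_le (fun i => ?_) hM
  rw [← minTensorRep_coe]
  exact h i.1 i.2

variable (G) in
theorem diagonal_le (x : MonoidAlgebra ℂ G) :
    ‖integratedForm (diagonalUnitary G) x‖ ≤ (groupSeminorm G).toFun x := by
  obtain ⟨y, hy⟩ := exists_diagonal x
  rw [← hy]
  refine norm_minTensor_le y ((groupSeminorm G).nonneg x) fun σ π => ?_
  rw [hy, integratedForm_mapUnitary]
  exact integratedForm_le ⟨HilbertTensor σ.H π.H,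
    mapUnitary (minTensorRep σ π) (diagonalUnitary G)⟩ x

variable (G) in
/-- The comultiplication `δ_G : C*(G) → C*(G) ⊗ C*(G)`, with `δ_G(i_G(g)) = i_G(g) ⊗ i_G(g)`. -/
def comul : GroupCStar G →⋆ₐ[ℂ] MinTensor (GroupCStar G) (GroupCStar G) :=
  (groupSeminorm G).lift (integratedForm (diagonalUnitary G)) (diagonal_le G)

theorem comul_iG (g : G) : comul G (iG g) = tensor (iG g) (iG g) := by
  refine (CStarSeminorm.lift_coe _ _ (diagonal_le G) _).trans ?_
  rw [integratedForm_single, one_smul]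
  rfl

/-- A coaction of the discrete group `G` on the unital C⋆-algebra `B` is a unital
⋆-homomorphism `δ : B → B ⊗ C*(G)` such that the elements `δ(b)(1 ⊗ c)` span a dense subspace and
`(δ ⊗ id) ∘ δ = (id ⊗ δ_G) ∘ δ`, where `(B ⊗ C*(G)) ⊗ C*(G)` and `B ⊗ (C*(G) ⊗ C*(G))` are
identified by the isomorphism `(b ⊗ c) ⊗ d ↦ b ⊗ (c ⊗ d)`. -/
structure IsCoaction {B : Type u} [CStarAlgebra B]
    (δ : B →⋆ₐ[ℂ] MinTensor B (GroupCStar G)) : Prop where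
  dense : Dense (Submodule.span ℂ
    {x : MinTensor B (GroupCStar G) | ∃ (b : B) (c : GroupCStar G), x = δ b * tensor 1 c} :
      Set (MinTensor B (GroupCStar G)))
  coassoc : ∃ α : MinTensor (MinTensor B (GroupCStar G)) (GroupCStar G) ≃⋆ₐ[ℂ]
      MinTensor B (MinTensor (GroupCStar G) (GroupCStar G)),
    (∀ (b : B) (c d : GroupCStar G), α (tensor (tensor b c) d) = tensor b (tensor c d)) ∧
    ∀ b : B, α (minTensorMap δ (StarAlgHom.id ℂ _) (δ b)) =
      minTensorMap (StarAlgHom.id ℂ B) (comul G) (δ b)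

end Coaction

/-! ### Product systems and twisted crossed products -/

section CrossedProduct

/-- A (discrete) product system over `P`: a family of nontrivial Hilbert spaces, one-dimensional
over the identity, with an associative multiplication on the total space such that
`(u, v) ↦ u v` extends to a unitary of `E_s ⊗ E_t` onto `E_{st}`. -/
structure ProductSystem (P : Type u) [Monoid P] where
  fiber : P → Type u
  [normedAddCommGroup : ∀ t, NormedAddCommGroup (fiber t)]
  [innerProductSpace : ∀ t, InnerProductSpace ℂ (fiber t)]
  [completeSpace : ∀ t, CompleteSpace (fiber t)]
  [nontrivial : ∀ t, Nontrivial (fiber t)]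
  finrank_one : Module.finrank ℂ (fiber 1) = 1
  mul : ∀ {s t : P}, fiber s → fiber t → fiber (s * t)
  mul_assoc : ∀ {r s t : P} (u : fiber r) (v : fiber s) (w : fiber t),
    (⟨r * s * t, mul (mul u v) w⟩ : Σ t, fiber t) = ⟨r * (s * t), mul u (mul v w)⟩
  exists_unitary : ∀ s t : P, ∃ U : HilbertTensor (fiber s) (fiber t) ≃ₗᵢ[ℂ] fiber (s * t),
    ∀ (u : fiber s) (v : fiber t), U (toHilbertTensor (u ⊗ₜ v)) = mul u v

attribute [instance] ProductSystem.normedAddCommGroup ProductSystem.innerProductSpace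
  ProductSystem.completeSpace ProductSystem.nontrivial

namespace ProductSystem

variable {P : Type u} [Monoid P] (E : ProductSystem P)

/-- The total space of a product system, a semigroup. -/
def Total : Type u := Σ t, E.fiber t

instance : Semigroup E.Total where
  mul x y := ⟨x.1 * y.1, E.mul x.2 y.2⟩
  mul_assoc x y z := E.mul_assoc x.2 y.2 z.2

/-- The projection `p : E → P`. -/
def p : E.Total →ₙ* P where
  toFun := Sigma.fst
  map_mul' _ _ := rfl

/-- An element of the fibre over `t`, as an element of the total space. -/
def incl (t : P) (v : E.fiber t) : E.Total := ⟨t, v⟩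

variable {H : Type u} [NormedAddCommGroup H] [InnerProductSpace ℂ H] [CompleteSpace H]

/-- Representations of a product system on a Hilbert space. (Mathlib's inner product is linear in
the second variable.) -/
structure IsRepresentation (φ : E.Total → (H →L[ℂ] H)) : Prop where
  map_mul : ∀ x y : E.Total, φ (x * y) = φ x * φ y
  star_mul : ∀ (t : P) (u v : E.fiber t),
    star (φ (E.incl t v)) * φ (E.incl t u) = (inner ℂ v u : ℂ) • (1 : H →L[ℂ] H)

variable {A : Type u} [CStarAlgebra A] (β : P →* (A →⋆ₙₐ[ℂ] A))

/-- Covariant representations of the twisted system `(A, P, β, E)`: for every orthonormal basis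
`(e_i)` of `E_s`, the sum `∑ φ(e_i) π(a) φ(e_i)⋆` converges strongly to `π(β_s(a))`. -/
structure IsCovariant (π : A →⋆ₐ[ℂ] (H →L[ℂ] H)) (φ : E.Total → (H →L[ℂ] H)) : Prop where
  isRepresentation : E.IsRepresentation φ
  covariant : ∀ (s : P) (a : A) (ι : Type u) (e : HilbertBasis ι ℂ (E.fiber s)) (h : H),
    HasSum (fun i => (φ (E.incl s (e i)) * π a * star (φ (E.incl s (e i)))) h) (π (β s a) h)

/-- The twisted system `(A, P, β, E)` has a covariant representation on a nonzero Hilbert space. -/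
def HasCovariantRep : Prop :=
  ∃ (H : Type u) (_ : NormedAddCommGroup H) (_ : InnerProductSpace ℂ H) (_ : CompleteSpace H)
    (_ : Nontrivial H) (π : A →⋆ₐ[ℂ] (H →L[ℂ] H)) (φ : E.Total → (H →L[ℂ] H)),
    E.IsCovariant β π φ

/-- `(B, i_A, i_E)` is a crossed product for the twisted system `(A, P, β, E)`. -/
structure IsCrossedProduct {B : Type u} [CStarAlgebra B] (iA : A →⋆ₐ[ℂ] B) (iE : E.Total → B) :
    Prop where
  exists_faithful : ∃ (H : Type u) (_ : NormedAddCommGroup H) (_ : InnerProductSpace ℂ H)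
    (_ : CompleteSpace H) (_ : Nontrivial H) (σ : B →⋆ₐ[ℂ] (H →L[ℂ] H)),
    Function.Injective σ ∧ E.IsCovariant β (σ.comp iA) (σ ∘ iE)
  exists_lift : ∀ (H : Type u) [NormedAddCommGroup H] [InnerProductSpace ℂ H] [CompleteSpace H]
    [Nontrivial H] (π : A →⋆ₐ[ℂ] (H →L[ℂ] H)) (φ : E.Total → (H →L[ℂ] H)),
    E.IsCovariant β π φ →
      ∃ ρ : B →⋆ₐ[ℂ] (H →L[ℂ] H), ρ.comp iA = π ∧ ρ ∘ iE = φ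
  generates : (StarAlgebra.adjoin ℂ (Set.range iA ∪ Set.range iE)).topologicalClosure = ⊤

end ProductSystem

end CrossedProduct

end

/-! Existence. A covariant representation assigns an operator norm to every ⋆-polynomial in the
generators `A ⊕ E.Total`. Each such norm is bounded independently of the representation, because `‖π
a‖ ≤ ‖a‖` and `‖φ v‖ ≤ ‖v‖`. Only a set of norm functions occurs. Choosing one covariant
representation for each and taking the direct sum gives a covariant representation
(`IsCovariant.directSum`) that dominates all others. The C⋆-algebra it generates is a crossed
product, since an assignment on generators that does not increase the norms of ⋆-polynomials extends
to a ⋆-homomorphism (`StarAlgHom.exists_lift_of_norm_le`).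

Coaction. Let `σ` be a faithful representation of `B` making the generators covariant, and `ω` a
faithful representation of `C*(G)`. The operators `σ(i_A(a)) ⊗ 1` and `σ(i_E(v)) ⊗ ω(i_G(p(v)))` are
again covariant, because the unitaries in the second factor cancel in `∑ φ(e_i) π(a) φ(e_i)⋆`
(`IsCovariant.tensor`). The universal property yields `ρ` on `B` mapping generators into the image
of `σ ⊗ ω`. As `σ ⊗ ω` is faithful on the minimal tensor product, `ρ` factors as `(σ ⊗ ω) ∘ δ`.
Replacing `ω` by the trivial representation turns `δ` into `σ ⊗ 1`, whence injectivity. Density and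
coassociativity are checked on the homogeneous elements, those with `δ(b) = b ⊗ i_G(g)`, whose span
is dense.

The analytic core is `minTensorRep_injective`: the supremum defining the minimal norm is attained at
any pair of faithful representations. Compression to finitely many orthonormal vectors of the second
space reduces this to matrices over `B`, where an injective ⋆-homomorphism is isometric and every
other one is contractive.

Dual action. Multiplying `φ` by a character preserves covariance (`IsCovariant.smul`), and the same
factorization, now through `σ` itself, gives the automorphisms. Norm continuity of orbits passes
from the generators to the closed ⋆-subalgebra they generate. -/

/-! ### Homomorphisms determined by their values on generators -/

section Lifting

variable {X Y Z : Type*} [CStarAlgebra X] [CStarAlgebra Y] [CStarAlgebra Z]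

theorem StarAlgHom.continuous_of_cstar (f : X →⋆ₐ[ℂ] Y) : Continuous f :=
  AddMonoidHomClass.continuous_of_bound f 1 fun x => by
    simpa only [one_mul] using NonUnitalStarAlgHom.norm_apply_le f x

theorem StarAlgHom.mem_of_topologicalClosure_adjoin_eq_top {s : Set X}
    (hs : (StarAlgebra.adjoin ℂ s).topologicalClosure = ⊤) {S : StarSubalgebra ℂ X}
    (hS : IsClosed (S : Set X)) (h : s ⊆ S) (x : X) : x ∈ S :=
  StarSubalgebra.topologicalClosure_minimal (StarAlgebra.adjoin_le h) hS (hs ▸ trivial)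

/-- ⋆-homomorphisms that agree on a generating set are equal. -/
theorem StarAlgHom.ext_of_topologicalClosure_adjoin_eq_top {s : Set X}
    (hs : (StarAlgebra.adjoin ℂ s).topologicalClosure = ⊤) {f g : X →⋆ₐ[ℂ] Y}
    (h : ∀ x ∈ s, f x = g x) : f = g := by
  ext x
  exact StarAlgHom.mem_of_topologicalClosure_adjoin_eq_top hs (S := StarAlgHom.equalizer f g)
    (isClosed_eq f.continuous_of_cstar g.continuous_of_cstar) h x

/-- A ⋆-homomorphism `ρ` that maps generators into the image of an injective ⋆-homomorphism `T`
factors through `T`. -/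
theorem StarAlgHom.exists_lift_of_injective {ι : Type*} {g : ι → X} {f : ι → Y}
    (hg : (StarAlgebra.adjoin ℂ (Set.range g)).topologicalClosure = ⊤) {T : Y →⋆ₐ[ℂ] Z}
    (hT : Function.Injective T) {ρ : X →⋆ₐ[ℂ] Z} (h : ∀ i, ρ (g i) = T (f i)) :
    ∃ δ : X →⋆ₐ[ℂ] Y, (∀ i, δ (g i) = f i) ∧ ∀ x, T (δ x) = ρ x := by
  -- An injective ⋆-homomorphism of C⋆-algebras is isometric, so its range is complete.
  have hcl : IsClosed (T.range : Set Z) := by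
    have : (T.range : Set Z) = Set.range T := rfl
    rw [this]
    exact (NonUnitalStarAlgHom.isometry T hT).isClosedEmbedding.isClosed_range
  have hmem : ∀ x, ρ x ∈ T.range := fun x =>
    StarAlgHom.mem_of_topologicalClosure_adjoin_eq_top hg (S := T.range.comap ρ)
      (hcl.preimage ρ.continuous_of_cstar)
      (by rintro _ ⟨i, rfl⟩; exact ⟨f i, (h i).symm⟩) x
  let e := StarAlgEquiv.ofInjective T hT
  let δ : X →⋆ₐ[ℂ] Y := (e.symm : T.range →⋆ₐ[ℂ] Y).comp (ρ.codRestrict T.range hmem)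
  have hδ : ∀ x, T (δ x) = ρ x := fun x =>
    congrArg Subtype.val (e.apply_symm_apply ⟨ρ x, hmem x⟩)
  exact ⟨δ, fun i => hT ((hδ _).trans (h i)), hδ⟩

/-- An assignment on generators that is norm decreasing on ⋆-polynomials extends to a
⋆-homomorphism. -/
theorem StarAlgHom.exists_lift_of_norm_le {ι : Type*} {g : ι → X} {f : ι → Y}
    (hg : (StarAlgebra.adjoin ℂ (Set.range g)).topologicalClosure = ⊤)
    (h : ∀ s ∈ StarAlgebra.adjoin ℂ (Set.range fun i => (g i, f i)), ‖s.2‖ ≤ ‖s.1‖) :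
    ∃ δ : X →⋆ₐ[ℂ] Y, ∀ i, δ (g i) = f i := by
  -- `S` is the graph of the homomorphism to be constructed. The norm inequality survives the
  -- closure and makes the first projection injective on `S`, so the identity of `X` lifts through
  -- it; the second projection then gives `δ`.
  let S := (StarAlgebra.adjoin ℂ (Set.range fun i => (g i, f i))).topologicalClosure
  have hS : ∀ s ∈ S, ‖s.2‖ ≤ ‖s.1‖ := fun s hs =>
    closure_minimal (t := {s : X × Y | ‖s.2‖ ≤ ‖s.1‖}) h
      (isClosed_le (by fun_prop) (by fun_prop)) hs
  -- Closedness makes `S` a C⋆-algebra, as the lifting through `T` requires.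
  have hcl : IsClosed (S : Set (X × Y)) := StarSubalgebra.isClosed_topologicalClosure _
  let T : S →⋆ₐ[ℂ] X := (StarAlgHom.fst ℂ X Y).comp S.subtype
  have hT : Function.Injective T := by
    refine (injective_iff_map_eq_zero T).2 fun s hs => ?_
    have h1 : s.1.1 = 0 := hs
    have h2 := hS s.1 s.2
    rw [h1, norm_zero, norm_le_zero_iff] at h2
    exact Subtype.ext (Prod.ext h1 h2)
  obtain ⟨δ, h1, -⟩ := StarAlgHom.exists_lift_of_injective (ρ := StarAlgHom.id ℂ X) hg hT
    (f := fun i => ⟨(g i, f i), StarSubalgebra.le_topologicalClosure _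
      (StarAlgebra.subset_adjoin _ _ ⟨i, rfl⟩)⟩) (fun i => rfl)
  exact ⟨((StarAlgHom.snd ℂ X Y).comp S.subtype).comp δ, fun i =>
    congrArg (fun s : S => s.1.2) (h1 i)⟩

/-- C⋆-algebras with corresponding generators in a common C⋆-algebra are isomorphic. -/
theorem StarAlgEquiv.exists_of_injective {ι : Type*} {g : ι → X} {f : ι → Y}
    (hg : (StarAlgebra.adjoin ℂ (Set.range g)).topologicalClosure = ⊤)
    (hf : (StarAlgebra.adjoin ℂ (Set.range f)).topologicalClosure = ⊤) {S : X →⋆ₐ[ℂ] Z}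
    (hS : Function.Injective S) {T : Y →⋆ₐ[ℂ] Z} (hT : Function.Injective T)
    (h : ∀ i, S (g i) = T (f i)) : ∃ α : X ≃⋆ₐ[ℂ] Y, ∀ i, α (g i) = f i := by
  obtain ⟨α, hα, -⟩ := StarAlgHom.exists_lift_of_injective hg hT h
  obtain ⟨β, hβ, -⟩ := StarAlgHom.exists_lift_of_injective hf hS fun i => (h i).symm
  have h1 : β.comp α = StarAlgHom.id ℂ _ := StarAlgHom.ext_of_topologicalClosure_adjoin_eq_top hg
    (by rintro _ ⟨p, rfl⟩; exact (congrArg β (hα p)).trans (hβ p))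
  have h2 : α.comp β = StarAlgHom.id ℂ _ := StarAlgHom.ext_of_topologicalClosure_adjoin_eq_top hf
    (by rintro _ ⟨p, rfl⟩; exact (congrArg α (hβ p)).trans (hα p))
  exact ⟨StarAlgEquiv.ofStarAlgHom α β h1 h2, hα⟩

end Lifting

/-! ### Unitary conjugation, direct sums, and faithful representations -/

section Conjugation

variable {H K : Type*} [NormedAddCommGroup H] [InnerProductSpace ℂ H] [CompleteSpace H]
  [NormedAddCommGroup K] [InnerProductSpace ℂ K] [CompleteSpace K]

/-- Conjugation by a unitary operator. -/
noncomputable def conjHom (W : H ≃ₗᵢ[ℂ] K) : (H →L[ℂ] H) →⋆ₐ[ℂ] (K →L[ℂ] K) :=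
  W.conjStarAlgEquiv.toStarAlgHom

theorem conjHom_apply (W : H ≃ₗᵢ[ℂ] K) (T : H →L[ℂ] H) (x : H) :
    conjHom W T (W x) = W (T x) := congrArg (fun y => W (T y)) (W.symm_apply_apply x)

theorem conjHom_injective (W : H ≃ₗᵢ[ℂ] K) : Function.Injective (conjHom W) :=
  EquivLike.injective W.conjStarAlgEquiv

theorem norm_conjHom (W : H ≃ₗᵢ[ℂ] K) (T : H →L[ℂ] H) : ‖conjHom W T‖ = ‖T‖ :=
  NonUnitalStarAlgHom.norm_map (conjHom W) (conjHom_injective W) T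

theorem conjHom_eq_of_comp_eq {W : H ≃ₗᵢ[ℂ] K} {S : H →L[ℂ] H} {T : K →L[ℂ] K}
    (h : ∀ x, W (S x) = T (W x)) : conjHom W S = T := by
  ext y
  obtain ⟨x, rfl⟩ := W.surjective y
  rw [conjHom_apply, h]

end Conjugation

section DirectSum

variable {ι : Type*} {H : ι → Type*} [∀ i, NormedAddCommGroup (H i)]
  [∀ i, InnerProductSpace ℂ (H i)] 

/-- The direct sum of a bounded family of operators. -/
noncomputable def directSumOp (T : ∀ i, H i →L[ℂ] H i) {K : ℝ} (hK : 0 ≤ K)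
    (hT : ∀ i, ‖T i‖ ≤ K) : lp H 2 →L[ℂ] lp H 2 := lp.mapCLM 2 T hK hT

theorem directSumOp_apply (T : ∀ i, H i →L[ℂ] H i) {K : ℝ} (hK : 0 ≤ K)
    (hT : ∀ i, ‖T i‖ ≤ K) (x : lp H 2) (i : ι) : directSumOp T hK hT x i = T i (x i) := rfl

theorem directSumOp_ext {S T : lp H 2 →L[ℂ] lp H 2} (h : ∀ x i, S x i = T x i) : S = T :=
  ContinuousLinearMap.ext fun x => lp.ext (funext (h x))

theorem directSumOp_single [DecidableEq ι] (T : ∀ i, H i →L[ℂ] H i) {K : ℝ} (hK : 0 ≤ K)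
    (hT : ∀ i, ‖T i‖ ≤ K) (i : ι) (x : H i) :
    directSumOp T hK hT (lp.single 2 i x) = lp.single 2 i (T i x) := by
  refine lp.ext (funext fun j => ?_)
  rw [directSumOp_apply]
  by_cases hj : j = i
  · subst hj; simp
  · simp [hj]

variable [∀ i, CompleteSpace (H i)]

theorem star_directSumOp (T : ∀ i, H i →L[ℂ] H i) {K : ℝ} (hK : 0 ≤ K) (hT : ∀ i, ‖T i‖ ≤ K) :
    star (directSumOp T hK hT) =
      directSumOp (fun i => star (T i)) hK (fun i => (norm_star _).trans_le (hT i)) := by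
  symm
  rw [ContinuousLinearMap.star_eq_adjoint, ContinuousLinearMap.eq_adjoint_iff]
  intro x y
  rw [lp.inner_eq_tsum, lp.inner_eq_tsum]
  refine tsum_congr fun i => ?_
  rw [directSumOp_apply, directSumOp_apply, ContinuousLinearMap.star_eq_adjoint,
    ContinuousLinearMap.adjoint_inner_left]

/-- The direct sum of a family of representations of a C⋆-algebra. -/
noncomputable def directSumRep {X : Type*} [CStarAlgebra X] (π : ∀ i, X →⋆ₐ[ℂ] (H i →L[ℂ] H i)) :
    X →⋆ₐ[ℂ] (lp H 2 →L[ℂ] lp H 2) where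
  toFun x := directSumOp (fun i => π i x) (norm_nonneg x)
    fun i => NonUnitalStarAlgHom.norm_apply_le (π i) x
  map_one' := directSumOp_ext fun x i => by rw [directSumOp_apply, map_one]; rfl
  map_mul' a b := directSumOp_ext fun x i => by rw [directSumOp_apply, map_mul]; rfl
  map_zero' := directSumOp_ext fun x i => by rw [directSumOp_apply, map_zero]; rfl
  map_add' a b := directSumOp_ext fun x i => by rw [directSumOp_apply, map_add]; rfl
  commutes' c := directSumOp_ext fun x i => by
    rw [directSumOp_apply, AlgHomClass.commutes, Algebra.algebraMap_eq_smul_one,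
      Algebra.algebraMap_eq_smul_one]; rfl
  map_star' a := by
    rw [star_directSumOp]
    exact directSumOp_ext fun x i => by rw [directSumOp_apply, map_star]; rfl

theorem directSumRep_apply {X : Type*} [CStarAlgebra X] (π : ∀ i, X →⋆ₐ[ℂ] (H i →L[ℂ] H i))
    (a : X) (x : lp H 2) (i : ι) : directSumRep π a x i = π i a (x i) := rfl

theorem directSumRep_single [DecidableEq ι] {X : Type*} [CStarAlgebra X]
    (π : ∀ i, X →⋆ₐ[ℂ] (H i →L[ℂ] H i)) (a : X) (i : ι) (x : H i) :
    directSumRep π a (lp.single 2 i x) = lp.single 2 i (π i a x) :=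
  directSumOp_single (fun i => π i a) (norm_nonneg a)
    (fun i => NonUnitalStarAlgHom.norm_apply_le (π i) a) i x

theorem eq_zero_of_directSumRep_eq_zero {X : Type*} [CStarAlgebra X]
    {π : ∀ i, X →⋆ₐ[ℂ] (H i →L[ℂ] H i)} {a : X} (h : directSumRep π a = 0) (i : ι) :
    π i a = 0 := by
  classical
  ext x
  have h1 := directSumRep_apply π a (lp.single 2 i x) i
  rw [h, lp.single_apply_self] at h1
  exact h1.symm

end DirectSum

/-- A C⋆-algebra whose representations separate points has a faithful representation. -/
theorem CStarRep.exists_injective {X : Type u} [CStarAlgebra X]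
    (h : ∀ x : X, x ≠ 0 → ∃ σ : CStarRep X, σ.π x ≠ 0) :
    ∃ σ : CStarRep X, Function.Injective σ.π := by
  choose σ hσ using h
  -- Indexing by the nonzero elements of `X` keeps the direct sum in the universe of `X`.
  let π := directSumRep fun x : {x : X // x ≠ 0} => (σ x.1 x.2).π
  refine ⟨⟨_, π⟩, (injective_iff_map_eq_zero π).2 fun x hx => ?_⟩
  by_contra hne
  exact hσ x hne (eq_zero_of_directSumRep_eq_zero hx ⟨x, hne⟩)

section GroupCStar

variable {G : Type u} [Group G]

/-- The representation of the group C⋆-algebra defined by a unitary representation. -/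
noncomputable def UnitaryRep.toCStarRep (U : UnitaryRep G) : CStarRep (GroupCStar G) :=
  ⟨U.H, (groupSeminorm G).lift (integratedForm U.U) (integratedForm_le U)⟩

theorem UnitaryRep.toCStarRep_coe (U : UnitaryRep G) (x : MonoidAlgebra ℂ G) :
    U.toCStarRep.π ((groupSeminorm G).coe x) = integratedForm U.U x :=
  CStarSeminorm.lift_coe _ _ (integratedForm_le U) x

theorem UnitaryRep.toCStarRep_iG (U : UnitaryRep G) (g : G) :
    U.toCStarRep.π (iG g) = (U.U g : U.H →L[ℂ] U.H) := by
  rw [iG, toCStarRep_coe, integratedForm_single, one_smul]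

variable (G) in
-- If every representation kills `x`, then `‖U(r)‖ = ‖U(x - r)‖ ≤ ‖x - r‖` for each `r` in the group
-- algebra and each unitary representation `U`, hence `‖r‖ ≤ ‖x - r‖`. This inequality is closed in
-- `r`, and at `r = x` it forces `x = 0`.
theorem GroupCStar.exists_injective_rep :
    ∃ σ : CStarRep (GroupCStar G), Function.Injective σ.π := by
  refine CStarRep.exists_injective fun x hx => ?_
  by_contra! h
  have hle : ∀ r : MonoidAlgebra ℂ G,
      ‖(groupSeminorm G).coe r‖ ≤ ‖x - (groupSeminorm G).coe r‖ := by
    intro r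
    rw [CStarSeminorm.norm_coe]
    refine Real.iSup_le (fun U => ?_) (norm_nonneg _)
    rw [← U.toCStarRep_coe]
    have h1 := NonUnitalStarAlgHom.norm_apply_le U.toCStarRep.π (x - (groupSeminorm G).coe r)
    rwa [map_sub, h, zero_sub, norm_neg] at h1
  have h2 : ‖x‖ ≤ ‖x - x‖ := by
    refine (groupSeminorm G).isClosed_induction (C := fun y => ‖y‖ ≤ ‖x - y‖) ?_ hle x
    exact isClosed_le (by fun_prop) (by fun_prop)
  rw [sub_self, norm_zero, norm_le_zero_iff] at h2
  exact hx h2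

end GroupCStar

/-! ### The spatial norm does not depend on the faithful representation -/

section Corner

open InnerProductSpace

section

variable (H K : Type*) [NormedAddCommGroup H] [InnerProductSpace ℂ H]
  [NormedAddCommGroup K] [InnerProductSpace ℂ K]

/-- The operation `(S, T) ↦ S ⊗ T` on operators, as a bilinear map. -/
noncomputable def opTensorₗ :
    (H →L[ℂ] H) →ₗ[ℂ] (K →L[ℂ] K) →ₗ[ℂ] (HilbertTensor H K →L[ℂ] HilbertTensor H K) :=
  LinearMap.mk₂ ℂ opTensor opTensor_add_left opTensor_smul_left opTensor_add_right
    opTensor_smul_right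

variable {H K}

theorem opTensorₗ_apply (S : H →L[ℂ] H) (T : K →L[ℂ] K) : opTensorₗ H K S T = opTensor S T := rfl

theorem toHilbertTensor_tmul_op (S : H →L[ℂ] H) (T : K →L[ℂ] K) (h : H) (k : K) :
    opTensor S T (toHilbertTensor (h ⊗ₜ k)) = toHilbertTensor (S h ⊗ₜ T k) := by
  rw [opTensor_coe, TensorProduct.mapL_tmul]

end

variable {ι : Type*} [Fintype ι] {B C : Type u} [CStarAlgebra B] [CStarAlgebra C]
  {H K : Type*} [NormedAddCommGroup H] [InnerProductSpace ℂ H] [CompleteSpace H]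
  [NormedAddCommGroup K] [InnerProductSpace ℂ K] [CompleteSpace K]

/-- The action of matrices over `B` on `H ⊗ K` through a representation of `B` on `H` and the matrix
units of an orthonormal family in `K`. -/
noncomputable def cornerRep (σ : B →⋆ₐ[ℂ] (H →L[ℂ] H)) {e : ι → K} (he : Orthonormal ℂ e) :
    CStarMatrix ι ι B →⋆ₙₐ[ℂ] (HilbertTensor H K →L[ℂ] HilbertTensor H K) where
  toFun M := ∑ i, ∑ j, opTensorₗ H K (σ (M i j)) (rankOne ℂ (e i) (e j))
  map_smul' c M := by simp [Finset.smul_sum]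
  map_zero' := by simp
  map_add' M N := by simp [Finset.sum_add_distrib]
  map_mul' M N := by
    classical
    have h1 : ∀ i j k l, opTensorₗ H K (σ (M i j)) (rankOne ℂ (e i) (e j)) *
        opTensorₗ H K (σ (N k l)) (rankOne ℂ (e k) (e l)) =
        if j = k then opTensorₗ H K (σ (M i j * N k l)) (rankOne ℂ (e i) (e l)) else 0 := by
      intro i j k l
      rw [opTensorₗ_apply, opTensorₗ_apply, ← opTensor_mul, ← map_mul σ,
        ContinuousLinearMap.mul_def (rankOne ℂ (e i) (e j)), rankOne_comp_rankOne,
        orthonormal_iff_ite.1 he, ← opTensorₗ_apply, map_smul]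
      split_ifs <;> simp
    rw [Finset.sum_mul_sum]
    refine Finset.sum_congr rfl fun i _ => ?_
    simp only [Finset.sum_mul_sum, h1, CStarMatrix.mul_apply, map_sum, LinearMap.sum_apply]
    rw [Finset.sum_comm]
    exact Finset.sum_congr rfl fun k _ => by simp
  map_star' M := by
    simp only [star_sum]
    rw [Finset.sum_comm]
    refine Finset.sum_congr rfl fun i _ => Finset.sum_congr rfl fun j _ => ?_
    rw [opTensorₗ_apply, opTensorₗ_apply, ← opTensor_star, ← map_star σ,
      ContinuousLinearMap.star_eq_adjoint (rankOne ℂ (e i) (e j)), adjoint_rankOne,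
      CStarMatrix.star_apply]

theorem cornerRep_apply (σ : B →⋆ₐ[ℂ] (H →L[ℂ] H)) {e : ι → K} (he : Orthonormal ℂ e)
    (M : CStarMatrix ι ι B) : cornerRep σ he M =
      ∑ i, ∑ j, opTensorₗ H K (σ (M i j)) (rankOne ℂ (e i) (e j)) := rfl

/-- Each entry of `M` can be read off from the operator, which is what makes `cornerRep` injective
for injective `σ`. -/
theorem cornerRep_inner (σ : B →⋆ₐ[ℂ] (H →L[ℂ] H)) {e : ι → K} (he : Orthonormal ℂ e)
    (M : CStarMatrix ι ι B) (i j : ι) (h h' : H) :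
    inner ℂ (toHilbertTensor (h' ⊗ₜ e i)) (cornerRep σ he M (toHilbertTensor (h ⊗ₜ e j))) =
      inner ℂ h' (σ (M i j) h) := by
  classical
  simp only [cornerRep_apply, sum_apply, opTensorₗ_apply,
    toHilbertTensor_tmul_op, inner_sum, LinearIsometry.inner_map_map, TensorProduct.inner_tmul,
    rankOne_apply, inner_smul_right, orthonormal_iff_ite.1 he]
  simp

theorem cornerRep_injective {σ : B →⋆ₐ[ℂ] (H →L[ℂ] H)} (hσ : Function.Injective σ) {e : ι → K}
    (he : Orthonormal ℂ e) : Function.Injective (cornerRep σ he) := by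
  refine (injective_iff_map_eq_zero _).2 fun M hM => ?_
  ext i j
  refine (injective_iff_map_eq_zero σ).1 hσ _ ?_
  ext h
  refine ext_inner_left ℂ fun h' => ?_
  rw [← cornerRep_inner σ he, hM]
  simp

/-- Matrices over `B` form a C⋆-algebra, on which `cornerRep σ he` is injective, hence isometric,
while `cornerRep τ he` is merely contractive. -/
theorem norm_cornerRep_le {H' : Type*} [NormedAddCommGroup H'] [InnerProductSpace ℂ H']
    [CompleteSpace H'] {σ : B →⋆ₐ[ℂ] (H →L[ℂ] H)} (hσ : Function.Injective σ)
    (τ : B →⋆ₐ[ℂ] (H' →L[ℂ] H')) {e : ι → K} (he : Orthonormal ℂ e) (M : CStarMatrix ι ι B) :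
    ‖cornerRep τ he M‖ ≤ ‖cornerRep σ he M‖ := by
  -- The C⋆-norm on matrices comes from a Hilbert module structure, which needs an order on `B`.
  let _ := CStarAlgebra.spectralOrder B
  let _ := CStarAlgebra.spectralOrderedRing B
  rw [NonUnitalStarAlgHom.norm_map (cornerRep σ he) (cornerRep_injective hσ he)]
  exact NonUnitalStarAlgHom.norm_apply_le _ M

omit [CompleteSpace K] in
theorem rankOne_sum_compression (e : ι → K) (T : K →L[ℂ] K) :
    (∑ i, rankOne ℂ (e i) (e i)) * T * (∑ i, rankOne ℂ (e i) (e i)) =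
      ∑ i, ∑ j, (inner ℂ (e i) (T (e j)) : ℂ) • rankOne ℂ (e i) (e j) := by
  rw [Finset.sum_mul, Finset.sum_mul_sum]
  refine Finset.sum_congr rfl fun i _ => Finset.sum_congr rfl fun j _ => ?_
  ext k
  simp [smul_smul, mul_comm]

/-- The point is that `M` is chosen before `σ`: for `y = b ⊗ c` its entries are `⟨e_i, π(c) e_j⟩ b`.
The same matrix thus serves for two representations of `B` that are to be compared. -/
theorem exists_compression_eq_cornerRep (π : C →⋆ₐ[ℂ] (K →L[ℂ] K)) {e : ι → K}
    (he : Orthonormal ℂ e) (y : B ⊗[ℂ] C) : ∃ M : CStarMatrix ι ι B, ∀ (H : Type u)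
      [NormedAddCommGroup H] [InnerProductSpace ℂ H] [CompleteSpace H] (σ : B →⋆ₐ[ℂ] (H →L[ℂ] H)),
      opTensor 1 (∑ i, rankOne ℂ (e i) (e i)) * repTensor σ π y *
        opTensor 1 (∑ i, rankOne ℂ (e i) (e i)) = cornerRep σ he M := by
  induction y using TensorProduct.induction_on with
  | zero => exact ⟨0, by intros; simp⟩
  | add x y hx hy =>
    obtain ⟨M, hM⟩ := hx
    obtain ⟨N, hN⟩ := hy
    exact ⟨M + N, by intros; rw [map_add, map_add, ← hM, ← hN, mul_add, add_mul]⟩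
  | tmul b c =>
    refine ⟨CStarMatrix.ofMatrix fun i j => (inner ℂ (e i) (π c (e j)) : ℂ) • b, ?_⟩
    intro H _ _ _ σ
    rw [repTensor_tmul, ← opTensor_mul, ← opTensor_mul, one_mul, mul_one, rankOne_sum_compression,
      cornerRep_apply, ← opTensorₗ_apply]
    simp only [map_sum, map_smul]
    refine Finset.sum_congr rfl fun i _ => Finset.sum_congr rfl fun j _ => ?_
    change _ = opTensorₗ H K (σ ((inner ℂ (e i) (π c (e j)) : ℂ) • b)) _
    rw [map_smul, map_smul, LinearMap.smul_apply]

omit [CompleteSpace H] [CompleteSpace K] in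
-- A vector of the algebraic tensor product lies in `H ⊗ K₀` for some finite-dimensional `K₀`; an
-- orthonormal basis of `K₀` gives the family, and the sum of rank-one operators is the projection
-- onto `K₀`.
theorem exists_orthonormal_opTensor_eq (x : H ⊗[ℂ] K) : ∃ (n : ℕ) (e : Fin n → K),
    Orthonormal ℂ e ∧ ‖(∑ i, rankOne ℂ (e i) (e i) : K →L[ℂ] K)‖ ≤ 1 ∧
      opTensor 1 (∑ i, rankOne ℂ (e i) (e i)) (toHilbertTensor x) = toHilbertTensor x := by
  obtain ⟨K₀, hK₀, hx⟩ := TensorProduct.exists_finite_submodule_right_of_setFinite {x}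
    (Set.finite_singleton x)
  obtain ⟨y, hy⟩ := hx rfl
  rw [← hy]
  clear hx hy
  let b := stdOrthonormalBasis ℂ K₀
  have hP : (∑ i, rankOne ℂ (b i : K) (b i : K)) = K₀.starProjection :=
    b.starProjection_eq_sum_rankOne.symm
  refine ⟨_, fun i => (b i : K), b.orthonormal.comp_linearIsometry K₀.subtypeₗᵢ, ?_, ?_⟩
  · rw [hP]
    exact K₀.starProjection_norm_le
  · rw [hP]
    induction y using TensorProduct.induction_on with
    | zero => simp
    | add y z hy hz => rw [map_add, map_add, map_add, hy, hz]
    | tmul h k =>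
      rw [LinearMap.lTensor_tmul, toHilbertTensor_tmul_op]
      simp

end Corner

/-- The spatial norm does not increase when a faithful representation of the first factor is
replaced by an arbitrary one. -/
theorem norm_repTensor_le_of_injective_left {B C : Type u} [CStarAlgebra B] [CStarAlgebra C]
    {H H' : Type u} {K : Type*} [NormedAddCommGroup H] [InnerProductSpace ℂ H] [CompleteSpace H]
    [NormedAddCommGroup H'] [InnerProductSpace ℂ H'] [CompleteSpace H']
    [NormedAddCommGroup K] [InnerProductSpace ℂ K] [CompleteSpace K]
    {σ : B →⋆ₐ[ℂ] (H →L[ℂ] H)} (hσ : Function.Injective σ) (τ : B →⋆ₐ[ℂ] (H' →L[ℂ] H'))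
    (π : C →⋆ₐ[ℂ] (K →L[ℂ] K)) (y : B ⊗[ℂ] C) : ‖repTensor τ π y‖ ≤ ‖repTensor σ π y‖ := by
  refine ContinuousLinearMap.opNorm_le_bound _ (norm_nonneg _) fun a => ?_
  refine hilbertTensor_induction (p := fun a => ‖repTensor τ π y a‖ ≤ ‖repTensor σ π y‖ * ‖a‖)
    (isClosed_le (by fun_prop) (by fun_prop)) (fun x => ?_) a
  obtain ⟨n, e, he, hP, hx⟩ := exists_orthonormal_opTensor_eq x
  -- Since `1 ⊗ P` fixes `ξ`, the number `‖(τ ⊗ π)(y) ξ‖²` is a matrix coefficient of the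
  -- compression of `(τ ⊗ π)(y⋆y)`, that is, of `cornerRep τ he M`. The latter has norm at most that
  -- of `cornerRep σ he M`, a compression of `(σ ⊗ π)(y⋆y)`.
  obtain ⟨M, hM⟩ := exists_compression_eq_cornerRep π he (star y * y)
  set P := ∑ i, InnerProductSpace.rankOne ℂ (e i) (e i) with hPdef
  set ξ : HilbertTensor H' K := toHilbertTensor x
  have hP1 : ∀ (H : Type u) [NormedAddCommGroup H] [InnerProductSpace ℂ H] [CompleteSpace H],
      ‖opTensor (1 : H →L[ℂ] H) P‖ ≤ 1 := by
    intro H _ _ _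
    exact (norm_opTensor_le _ _).trans
      (mul_le_one₀ ContinuousLinearMap.norm_id_le (norm_nonneg _) hP)
  have hstar : star (opTensor (1 : H' →L[ℂ] H') P) = opTensor 1 P := by
    rw [← opTensor_star, star_one, hPdef, star_sum]
    simp [ContinuousLinearMap.star_eq_adjoint]
  have h1 : ‖repTensor τ π y ξ‖ * ‖repTensor τ π y ξ‖ ≤ ‖cornerRep τ he M‖ * (‖ξ‖ * ‖ξ‖) := by
    have h2 : (inner ℂ (repTensor τ π y ξ) (repTensor τ π y ξ) : ℂ) =
        inner ℂ ξ (cornerRep τ he M ξ) := by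
      have h3 : ∀ z, (inner ℂ ξ (opTensor 1 P z) : ℂ) = inner ℂ ξ z := fun z => by
        rw [← ContinuousLinearMap.adjoint_inner_left, ← ContinuousLinearMap.star_eq_adjoint,
          hstar, hx]
      rw [← hM, mul_apply_eq_comp, mul_apply_eq_comp, hx, h3, map_mul, mul_apply_eq_comp, map_star,
        ContinuousLinearMap.star_eq_adjoint, ContinuousLinearMap.adjoint_inner_right]
    calc _ = ‖(inner ℂ (repTensor τ π y ξ) (repTensor τ π y ξ) : ℂ)‖ := by
          rw [inner_self_eq_norm_sq_to_K]; simp [sq]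
      _ ≤ ‖ξ‖ * ‖cornerRep τ he M ξ‖ := h2 ▸ norm_inner_le_norm _ _
      _ ≤ ‖ξ‖ * (‖cornerRep τ he M‖ * ‖ξ‖) := by gcongr; exact ContinuousLinearMap.le_opNorm _ _
      _ = _ := by ring
  have h2 : ‖cornerRep σ he M‖ ≤ ‖repTensor σ π y‖ * ‖repTensor σ π y‖ := by
    rw [← CStarRing.norm_star_mul_self, ← map_star, ← map_mul, ← hM]
    calc _ ≤ 1 * ‖repTensor σ π (star y * y)‖ * 1 :=
          (norm_mul_le _ _).trans (mul_le_mul ((norm_mul_le _ _).trans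
            (mul_le_mul_of_nonneg_right (hP1 H) (norm_nonneg _))) (hP1 H) (norm_nonneg _)
            (by positivity))
      _ = _ := by ring
  refine nonneg_le_nonneg_of_sq_le_sq (by positivity) (h1.trans ?_)
  calc _ ≤ ‖cornerRep σ he M‖ * (‖ξ‖ * ‖ξ‖) := by
        gcongr
        exact norm_cornerRep_le hσ τ he M
    _ ≤ ‖repTensor σ π y‖ * ‖repTensor σ π y‖ * (‖ξ‖ * ‖ξ‖) := by gcongr
    _ = _ := by ring

/-! ### Flip and associativity of Hilbert space tensor products -/

section HilbertTensor

variable {H K L : Type*} [NormedAddCommGroup H] [InnerProductSpace ℂ H]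
  [NormedAddCommGroup K] [InnerProductSpace ℂ K] [NormedAddCommGroup L] [InnerProductSpace ℂ L]

theorem denseRange_toHilbertTensor : DenseRange (toHilbertTensor : H ⊗[ℂ] K →ₗᵢ[ℂ] _) :=
  Completion.denseRange_coe (α := H ⊗[ℂ] K)

variable (H K) in
/-- The flip `H ⊗ K ≃ K ⊗ H` of Hilbert space tensor products. -/
noncomputable def hilbertTensorComm : HilbertTensor H K ≃ₗᵢ[ℂ] HilbertTensor K H :=
  (TensorProduct.comm ℂ H K).extendOfIsometry toHilbertTensor.toLinearMap
    toHilbertTensor.toLinearMap denseRange_toHilbertTensor denseRange_toHilbertTensor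
    fun x => by simp

theorem hilbertTensorComm_coe (x : H ⊗[ℂ] K) :
    hilbertTensorComm H K (toHilbertTensor x) = toHilbertTensor (TensorProduct.comm ℂ H K x) :=
  LinearEquiv.extendOfIsometry_eq _ _ _ denseRange_toHilbertTensor denseRange_toHilbertTensor
    (fun x => by simp) x

/-- For fixed `l`, the map `x ↦ x ⊗ l` is continuous, so approximating `x` by algebraic tensors puts
every elementary tensor `x ⊗ l` in the closed span. -/
theorem denseRange_rTensor_toHilbertTensor : DenseRange
    (toHilbertTensor.comp (LinearIsometry.rTensor L (toHilbertTensor (H := H) (K := K)))) := by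
  set e := toHilbertTensor.comp (LinearIsometry.rTensor L (toHilbertTensor (H := H) (K := K)))
  let S := e.toLinearMap.range.topologicalClosure
  have h : ∀ (x : HilbertTensor H K) (l : L), toHilbertTensor (x ⊗ₜ l) ∈ S := by
    intro x l
    refine hilbertTensor_induction (p := fun x => toHilbertTensor (x ⊗ₜ l) ∈ S) ?_ (fun z => ?_) x
    · exact e.toLinearMap.range.isClosed_topologicalClosure.preimage
        (by fun_prop : Continuous fun x : HilbertTensor H K => toHilbertTensor (x ⊗ₜ[ℂ] l))
    · exact Submodule.le_topologicalClosure _ ⟨z ⊗ₜ l, rfl⟩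
  intro a
  refine hilbertTensor_induction (p := fun a => a ∈ S)
    e.toLinearMap.range.isClosed_topologicalClosure (fun z => ?_) a
  induction z using TensorProduct.induction_on with
  | zero => simp
  | add x y hx hy => rw [map_add]; exact add_mem hx hy
  | tmul x l => exact h x l

theorem denseRange_lTensor_toHilbertTensor : DenseRange
    (toHilbertTensor.comp (LinearIsometry.lTensor L (toHilbertTensor (H := H) (K := K)))) := by
  set e := toHilbertTensor.comp (LinearIsometry.lTensor L (toHilbertTensor (H := H) (K := K)))
  let S := e.toLinearMap.range.topologicalClosure
  have h : ∀ (l : L) (x : HilbertTensor H K), toHilbertTensor (l ⊗ₜ x) ∈ S := by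
    intro l x
    refine hilbertTensor_induction (p := fun x => toHilbertTensor (l ⊗ₜ x) ∈ S) ?_ (fun z => ?_) x
    · exact e.toLinearMap.range.isClosed_topologicalClosure.preimage
        (by fun_prop : Continuous fun x : HilbertTensor H K => toHilbertTensor (l ⊗ₜ[ℂ] x))
    · exact Submodule.le_topologicalClosure _ ⟨l ⊗ₜ z, rfl⟩
  intro a
  refine hilbertTensor_induction (p := fun a => a ∈ S)
    e.toLinearMap.range.isClosed_topologicalClosure (fun z => ?_) a
  induction z using TensorProduct.induction_on with
  | zero => simp
  | add x y hx hy => rw [map_add]; exact add_mem hx hy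
  | tmul l x => exact h l x

variable (H K L) in
-- The algebraic associator is isometric, and the algebraic triple tensor product is dense in both
-- completions.
theorem exists_hilbertTensorAssoc :
    ∃ W : HilbertTensor (HilbertTensor H K) L ≃ₗᵢ[ℂ] HilbertTensor H (HilbertTensor K L),
      ∀ (h : H) (k : K) (l : L), W (toHilbertTensor (toHilbertTensor (h ⊗ₜ k) ⊗ₜ l)) =
        toHilbertTensor (h ⊗ₜ toHilbertTensor (k ⊗ₜ l)) := by
  let e₁ := toHilbertTensor.comp (LinearIsometry.rTensor L (toHilbertTensor (H := H) (K := K)))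
  let e₂ := toHilbertTensor.comp (LinearIsometry.lTensor H (toHilbertTensor (H := K) (K := L)))
  have hn : ∀ x, ‖e₂.toLinearMap (TensorProduct.assoc ℂ H K L x)‖ = ‖e₁.toLinearMap x‖ :=
    fun x => (e₂.norm_map _).trans ((TensorProduct.norm_assoc x).trans (e₁.norm_map x).symm)
  refine ⟨(TensorProduct.assoc ℂ H K L).extendOfIsometry e₁.toLinearMap e₂.toLinearMap
    denseRange_rTensor_toHilbertTensor denseRange_lTensor_toHilbertTensor hn, fun h k l => ?_⟩
  exact LinearEquiv.extendOfIsometry_eq _ e₁.toLinearMap e₂.toLinearMap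
    denseRange_rTensor_toHilbertTensor denseRange_lTensor_toHilbertTensor hn ((h ⊗ₜ k) ⊗ₜ l)

/-- Operators on an iterated tensor product agree if they agree on elementary tensors. -/
theorem hilbertTensor_ext_threefold {M : Type*} [NormedAddCommGroup M] [InnerProductSpace ℂ M]
    {S T : HilbertTensor (HilbertTensor H K) L →L[ℂ] M}
    (h : ∀ (x : H) (y : K) (z : L), S (toHilbertTensor (toHilbertTensor (x ⊗ₜ y) ⊗ₜ z)) =
      T (toHilbertTensor (toHilbertTensor (x ⊗ₜ y) ⊗ₜ z))) : S = T := by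
  refine ContinuousLinearMap.ext fun a => ?_
  refine congrFun (denseRange_rTensor_toHilbertTensor.equalizer S.continuous T.continuous
    (funext fun x => ?_)) a
  change S (toHilbertTensor (LinearMap.rTensor L toHilbertTensor.toLinearMap x)) =
    T (toHilbertTensor (LinearMap.rTensor L toHilbertTensor.toLinearMap x))
  induction x using TensorProduct.induction_on with
  | zero => simp
  | add x y hx hy => simp only [map_add, hx, hy]
  | tmul w z =>
    induction w using TensorProduct.induction_on with
    | zero => simp
    | add x y hx hy => simp only [TensorProduct.add_tmul, map_add, hx, hy]
    | tmul x y => exact h x y z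

theorem hilbertTensorAssoc_opTensor
    {W : HilbertTensor (HilbertTensor H K) L ≃ₗᵢ[ℂ] HilbertTensor H (HilbertTensor K L)}
    (hW : ∀ (h : H) (k : K) (l : L), W (toHilbertTensor (toHilbertTensor (h ⊗ₜ k) ⊗ₜ l)) =
        toHilbertTensor (h ⊗ₜ toHilbertTensor (k ⊗ₜ l)))
    (R : H →L[ℂ] H) (S : K →L[ℂ] K) (T : L →L[ℂ] L) (x : HilbertTensor (HilbertTensor H K) L) :
    W (opTensor (opTensor R S) T x) = opTensor R (opTensor S T) (W x) := by
  have h : (W.toContinuousLinearEquiv : _ →L[ℂ] _) ∘L opTensor (opTensor R S) T =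
      opTensor R (opTensor S T) ∘L (W.toContinuousLinearEquiv : _ →L[ℂ] _) := by
    refine hilbertTensor_ext_threefold fun x y z => ?_
    change W (opTensor _ _ _) = opTensor _ _ (W _)
    rw [hW, toHilbertTensor_tmul_op, toHilbertTensor_tmul_op, toHilbertTensor_tmul_op,
      toHilbertTensor_tmul_op, hW]
  exact congrArg (fun f => f x) h

end HilbertTensor

/-! ### Faithful representations and associativity of the minimal tensor product -/

section FaithfulTensor

variable {B C D : Type u} [CStarAlgebra B] [CStarAlgebra C] [CStarAlgebra D]

/-- The flip conjugates `σ ⊗ π` into `π ⊗ σ`. It transfers the comparison of representations of the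
first factor to the second. -/
theorem norm_repTensor_comm {H K : Type*} [NormedAddCommGroup H] [InnerProductSpace ℂ H]
    [CompleteSpace H] [NormedAddCommGroup K] [InnerProductSpace ℂ K] [CompleteSpace K]
    (σ : B →⋆ₐ[ℂ] (H →L[ℂ] H)) (π : C →⋆ₐ[ℂ] (K →L[ℂ] K)) (y : B ⊗[ℂ] C) :
    ‖repTensor π σ (TensorProduct.comm ℂ B C y)‖ = ‖repTensor σ π y‖ := by
  have h : conjHom (hilbertTensorComm H K) (repTensor σ π y) =
      repTensor π σ (TensorProduct.comm ℂ B C y) := by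
    induction y using TensorProduct.induction_on with
    | zero => simp
    | add x y hx hy => rw [map_add, map_add, map_add, map_add, hx, hy]
    | tmul b c =>
      refine conjHom_eq_of_comp_eq fun a => ?_
      refine hilbertTensor_induction (p := fun a => hilbertTensorComm H K (repTensor σ π _ a) =
        repTensor π σ _ (hilbertTensorComm H K a)) (isClosed_eq (by fun_prop) (by fun_prop))
        (fun x => ?_) a
      rw [TensorProduct.comm_tmul, hilbertTensorComm_coe, repTensor_tmul, repTensor_tmul,
        opTensor_coe, opTensor_coe, hilbertTensorComm_coe]
      congr 1
      induction x using TensorProduct.induction_on with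
      | zero => simp
      | add x y hx hy => simp only [map_add, hx, hy]
      | tmul x y => simp
  rw [← h, norm_conjHom]

theorem norm_repTensor_le_of_injective {σ : CStarRep B} (hσ : Function.Injective σ.π)
    {π : CStarRep C} (hπ : Function.Injective π.π) (σ' : CStarRep B) (π' : CStarRep C)
    (y : B ⊗[ℂ] C) : ‖repTensor σ'.π π'.π y‖ ≤ ‖repTensor σ.π π.π y‖ := by
  refine (norm_repTensor_le_of_injective_left hσ σ'.π π'.π y).trans ?_
  rw [← norm_repTensor_comm, ← norm_repTensor_comm σ.π π.π]
  exact norm_repTensor_le_of_injective_left hπ π'.π σ.π _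

/-- The tensor product of faithful representations is faithful on the minimal tensor product. -/
theorem minTensorRep_injective {σ : CStarRep B} (hσ : Function.Injective σ.π)
    {π : CStarRep C} (hπ : Function.Injective π.π) : Function.Injective (minTensorRep σ π) := by
  refine (injective_iff_map_eq_zero _).2 fun x hx => ?_
  -- On the algebraic tensor product the supremum defining the norm is attained at `(σ, π)`;
  -- continuity gives the rest.
  have h : ‖x‖ ≤ ‖minTensorRep σ π x‖ := by
    refine (minSeminorm B C).isClosed_induction (C := fun x => ‖x‖ ≤ ‖minTensorRep σ π x‖) ?_
      (fun y => ?_) x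
    · exact isClosed_le continuous_norm (minTensorRep σ π).continuous_of_cstar.norm
    · change ‖(minSeminorm B C).coe y‖ ≤ ‖minTensorRep σ π ((minSeminorm B C).coe y)‖
      refine norm_minTensor_le y (norm_nonneg _) fun σ' π' => ?_
      rw [minTensorRep_coe, minTensorRep_coe]
      exact norm_repTensor_le_of_injective hσ hπ σ' π' y
  rwa [hx, norm_zero, norm_le_zero_iff] at h

theorem minTensorRep_tensor (σ : CStarRep B) (π : CStarRep C) (b : B) (c : C) :
    minTensorRep σ π (tensor b c) = opTensor (σ.π b) (π.π c) := minTensorRep_coe σ π (b ⊗ₜ c)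

variable (B C) in
/-- The embedding `b ↦ b ⊗ 1`. -/
noncomputable def tensorLeft : B →⋆ₐ[ℂ] MinTensor B C where
  __ := (minSeminorm B C).coe.toAlgHom.comp Algebra.TensorProduct.includeLeft
  map_star' b := by
    change tensor (star b) 1 = star (tensor b 1)
    rw [star_tensor, star_one]

variable (B C) in
/-- The embedding `c ↦ 1 ⊗ c`. -/
noncomputable def tensorRight : C →⋆ₐ[ℂ] MinTensor B C where
  __ := (minSeminorm B C).coe.toAlgHom.comp Algebra.TensorProduct.includeRight
  map_star' c := by
    change tensor 1 (star c) = star (tensor 1 c)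
    rw [star_tensor, star_one]

theorem tensor_eq_mul (b : B) (c : C) : tensor b c = tensor b 1 * tensor 1 c := by
  rw [← tensor_mul, mul_one, one_mul]

theorem continuous_tensor_left (c : C) : Continuous fun b : B => tensor b c := by
  refine Continuous.congr ?_ fun b => (tensor_eq_mul b c).symm
  exact (tensorLeft B C).continuous_of_cstar.mul continuous_const

/-- A closed subspace containing all elementary tensors is everything. -/
theorem mem_of_tensor_mem {S : Submodule ℂ (MinTensor B C)}
    (hS : IsClosed (S : Set (MinTensor B C))) (h : ∀ b c, tensor b c ∈ S) (x : MinTensor B C) :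
    x ∈ S := by
  refine (minSeminorm B C).isClosed_induction (C := fun x => x ∈ S) hS (fun y => ?_) x
  change (minSeminorm B C).coe y ∈ S
  induction y using TensorProduct.induction_on with
  | zero => rw [map_zero]; exact zero_mem S
  | add x y hx hy => rw [map_add]; exact add_mem hx hy
  | tmul b c => exact h b c

theorem topologicalClosure_adjoin_tensor {s : Set (MinTensor B C)} (h : ∀ b c,
    tensor b c ∈ (StarAlgebra.adjoin ℂ s).topologicalClosure) :
    (StarAlgebra.adjoin ℂ s).topologicalClosure = ⊤ :=
  StarSubalgebra.eq_top_iff.2 fun x => mem_of_tensor_mem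
    (S := (StarAlgebra.adjoin ℂ s).topologicalClosure.toSubalgebra.toSubmodule)
    (StarSubalgebra.isClosed_topologicalClosure _) h x

variable (B C) in
theorem topologicalClosure_adjoin_range_tensor :
    (StarAlgebra.adjoin ℂ (Set.range fun p : B × C => tensor p.1 p.2)).topologicalClosure = ⊤ :=
  topologicalClosure_adjoin_tensor fun b c =>
    StarSubalgebra.le_topologicalClosure _ (StarAlgebra.subset_adjoin _ _ ⟨(b, c), rfl⟩)

variable (B C D) in
-- In the factorization `x ⊗ d = (x ⊗ 1)(1 ⊗ d)`, the map `x ↦ x ⊗ 1` is a continuous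
-- ⋆-homomorphism, so it suffices to treat the generators `x = b ⊗ c`.
theorem topologicalClosure_adjoin_tensor_left :
    (StarAlgebra.adjoin ℂ (Set.range fun p : (B × C) × D =>
      tensor (tensor p.1.1 p.1.2) p.2)).topologicalClosure = ⊤ := by
  set S := (StarAlgebra.adjoin ℂ (Set.range fun p : (B × C) × D =>
      tensor (tensor p.1.1 p.1.2) p.2)).topologicalClosure
  have h : ∀ b c d, tensor (tensor b c) d ∈ S := fun b c d =>
    StarSubalgebra.le_topologicalClosure _ (StarAlgebra.subset_adjoin _ _ ⟨((b, c), d), rfl⟩)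
  have hS : IsClosed (S : Set (MinTensor (MinTensor B C) D)) :=
    StarSubalgebra.isClosed_topologicalClosure _
  refine topologicalClosure_adjoin_tensor fun x d => ?_
  rw [tensor_eq_mul]
  refine mul_mem ?_ (by simpa only [tensor_one] using h 1 1 d)
  exact StarAlgHom.mem_of_topologicalClosure_adjoin_eq_top
    (topologicalClosure_adjoin_range_tensor B C) (S := S.comap (tensorLeft _ D))
    (hS.preimage (tensorLeft _ D).continuous_of_cstar)
    (by rintro _ ⟨p, rfl⟩; exact h p.1 p.2 1) x

variable (B C D) in
theorem topologicalClosure_adjoin_tensor_right :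
    (StarAlgebra.adjoin ℂ (Set.range fun p : (B × C) × D =>
      tensor p.1.1 (tensor p.1.2 p.2))).topologicalClosure = ⊤ := by
  set S := (StarAlgebra.adjoin ℂ (Set.range fun p : (B × C) × D =>
      tensor p.1.1 (tensor p.1.2 p.2))).topologicalClosure
  have h : ∀ b c d, tensor b (tensor c d) ∈ S := fun b c d =>
    StarSubalgebra.le_topologicalClosure _ (StarAlgebra.subset_adjoin _ _ ⟨((b, c), d), rfl⟩)
  have hS : IsClosed (S : Set (MinTensor B (MinTensor C D))) :=
    StarSubalgebra.isClosed_topologicalClosure _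
  refine topologicalClosure_adjoin_tensor fun b x => ?_
  rw [tensor_eq_mul]
  refine mul_mem (by simpa only [tensor_one] using h b 1 1) ?_
  exact StarAlgHom.mem_of_topologicalClosure_adjoin_eq_top
    (topologicalClosure_adjoin_range_tensor C D) (S := S.comap (tensorRight B _))
    (hS.preimage (tensorRight B _).continuous_of_cstar)
    (by rintro _ ⟨p, rfl⟩; exact h 1 p.1 p.2) x

/-- The associativity isomorphism of minimal tensor products. -/
theorem exists_minTensorAssoc (hB : ∃ σ : CStarRep B, Function.Injective σ.π)
    (hC : ∃ σ : CStarRep C, Function.Injective σ.π)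
    (hD : ∃ σ : CStarRep D, Function.Injective σ.π) :
    ∃ α : MinTensor (MinTensor B C) D ≃⋆ₐ[ℂ] MinTensor B (MinTensor C D),
      ∀ b c d, α (tensor (tensor b c) d) = tensor b (tensor c d) := by
  obtain ⟨σ, hσ⟩ := hB
  obtain ⟨π, hπ⟩ := hC
  obtain ⟨ω, hω⟩ := hD
  -- Both triple products are represented faithfully. After conjugation by the Hilbert space
  -- associator `W` they act on the same space, where corresponding generators coincide.
  let T₁ := minTensorRep ⟨_, minTensorRep σ π⟩ ω
  let T₂ := minTensorRep σ ⟨_, minTensorRep π ω⟩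
  have hT₁ : Function.Injective T₁ := minTensorRep_injective (minTensorRep_injective hσ hπ) hω
  have hT₂ : Function.Injective T₂ := minTensorRep_injective hσ (minTensorRep_injective hπ hω)
  obtain ⟨W, hW⟩ := exists_hilbertTensorAssoc σ.H π.H ω.H
  have hW' : Function.Injective ((conjHom W).comp T₁) := (conjHom_injective W).comp hT₁
  have key : ∀ p : (B × C) × D, conjHom W (T₁ (tensor (tensor p.1.1 p.1.2) p.2)) =
      T₂ (tensor p.1.1 (tensor p.1.2 p.2)) := fun p => by
    refine conjHom_eq_of_comp_eq fun x => ?_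
    obtain ⟨⟨b, c⟩, d⟩ := p
    dsimp only [T₁, T₂]
    rw [minTensorRep_tensor, minTensorRep_tensor]
    dsimp only
    rw [minTensorRep_tensor, minTensorRep_tensor]
    exact hilbertTensorAssoc_opTensor hW (σ.π b) (π.π c) (ω.π d) x
  obtain ⟨α, hα⟩ := StarAlgEquiv.exists_of_injective
    (topologicalClosure_adjoin_tensor_left B C D) (topologicalClosure_adjoin_tensor_right B C D)
    hW' hT₂ key
  exact ⟨α, fun b c d => hα ((b, c), d)⟩

end FaithfulTensor

/-! ### Constructing covariant representations: amplification, twisting, direct sums -/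

section StrongConvergence

variable {H : Type*} [NormedAddCommGroup H] [InnerProductSpace ℂ H]

/-- A series of operators with bounded partial sums that converges strongly on a total set converges
strongly. -/
theorem hasSum_apply_of_dense_span {ι : Type*} {f : ι → H →L[ℂ] H} {T : H →L[ℂ] H} {M : ℝ}
    (hM : ∀ F : Finset ι, ‖∑ i ∈ F, f i‖ ≤ M) {s : Set H}
    (hs : Dense (Submodule.span ℂ s : Set H)) (h : ∀ x ∈ s, HasSum (fun i => f i x) (T x))
    (x : H) : HasSum (fun i => f i x) (T x) := by
  have hspan : ∀ y ∈ Submodule.span ℂ s, HasSum (fun i => f i y) (T y) := by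
    intro y hy
    induction hy using Submodule.span_induction with
    | mem y hy => exact h y hy
    | zero => simp
    | add y z _ _ hy hz => simpa only [map_add] using hy.add hz
    | smul c y _ hy => simpa only [map_smul] using hy.const_smul c
  have hM0 : 0 ≤ M := (norm_nonneg _).trans (hM ∅)
  refine Metric.tendsto_nhds.2 fun ε hε => ?_
  -- The errors `M‖x - y‖` and `‖T‖‖x - y‖` must sum to at most `ε / 2`; the summand `1` keeps the
  -- denominator positive.
  obtain ⟨y, hy, hxy⟩ := hs.exists_dist_lt x (ε := ε / (2 * (M + ‖T‖ + 1))) (by positivity)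
  filter_upwards [Metric.tendsto_nhds.1 (hspan y hy) (ε / 2) (half_pos hε)] with F hF
  rw [dist_eq_norm] at hxy hF ⊢
  have h1 : ∑ i ∈ F, f i x - T x =
      (∑ i ∈ F, f i) (x - y) + (∑ i ∈ F, f i y - T y) - T (x - y) := by
    simp only [sum_apply, map_sub]
    abel
  have h2 : (M + ‖T‖) * ‖x - y‖ ≤ ε / 2 := by
    rw [lt_div_iff₀ (by positivity)] at hxy
    nlinarith [norm_nonneg (x - y)]
  calc _ ≤ ‖(∑ i ∈ F, f i) (x - y)‖ + ‖∑ i ∈ F, f i y - T y‖ + ‖T (x - y)‖ := by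
        rw [h1]
        exact (norm_sub_le _ _).trans (add_le_add_left (norm_add_le _ _) _)
    _ ≤ M * ‖x - y‖ + ‖∑ i ∈ F, f i y - T y‖ + ‖T‖ * ‖x - y‖ := by
        gcongr
        · exact ((∑ i ∈ F, f i).le_opNorm _).trans (by gcongr; exact hM F)
        · exact T.le_opNorm _
    _ < ε := by linarith

variable [CompleteSpace H]

/-- The ⋆-endomorphism `T ↦ ∑ Vᵢ T Vᵢ⋆` defined by a finite family of isometries with orthogonal
ranges. -/
noncomputable def isometrySum {ι : Type*} [DecidableEq ι] {V : ι → H →L[ℂ] H}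
    (hV : ∀ i j, star (V i) * V j = if i = j then 1 else 0) (F : Finset ι) :
    (H →L[ℂ] H) →⋆ₙₐ[ℂ] (H →L[ℂ] H) where
  toFun T := ∑ i ∈ F, V i * T * star (V i)
  map_smul' c T := by simp [Finset.smul_sum]
  map_zero' := by simp
  map_add' S T := by simp [mul_add, add_mul, Finset.sum_add_distrib]
  map_mul' S T := by
    rw [Finset.sum_mul_sum]
    refine Finset.sum_congr rfl fun i hi => ?_
    rw [Finset.sum_eq_single i]
    · rw [mul_assoc (V i * S), ← mul_assoc (star (V i)), ← mul_assoc (star (V i)), hV, if_pos rfl]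
      simp only [one_mul, mul_assoc]
    · intro j _ hj
      rw [mul_assoc (V i * S), ← mul_assoc (star (V i)), ← mul_assoc (star (V i)), hV,
        if_neg hj.symm]
      simp
    · exact fun h => absurd hi h
  map_star' T := by simp [star_sum, mul_assoc]

/-- ⋆-homomorphisms are contractive, so the bound is uniform in `F`. This is what lets covariance be
checked on a total set of vectors only. -/
theorem norm_isometrySum_le {ι : Type*} [DecidableEq ι] {V : ι → H →L[ℂ] H}
    (hV : ∀ i j, star (V i) * V j = if i = j then 1 else 0) (F : Finset ι) (T : H →L[ℂ] H) :
    ‖∑ i ∈ F, V i * T * star (V i)‖ ≤ ‖T‖ :=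
  NonUnitalStarAlgHom.norm_apply_le (isometrySum hV F) T

end StrongConvergence

section OpTensorLeft

variable (H K : Type*) [NormedAddCommGroup H] [InnerProductSpace ℂ H] [CompleteSpace H]
  [NormedAddCommGroup K] [InnerProductSpace ℂ K] [CompleteSpace K]

/-- The amplification `S ↦ S ⊗ 1`. -/
noncomputable def opTensorLeft :
    (H →L[ℂ] H) →⋆ₐ[ℂ] (HilbertTensor H K →L[ℂ] HilbertTensor H K) where
  toFun S := opTensor S 1
  map_one' := opTensor_one
  map_mul' S T := by rw [← opTensor_mul, one_mul]
  map_zero' := by rw [← opTensorₗ_apply, map_zero, LinearMap.zero_apply]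
  map_add' S T := opTensor_add_left S T 1
  commutes' c := by
    rw [Algebra.algebraMap_eq_smul_one, Algebra.algebraMap_eq_smul_one, opTensor_smul_left,
      opTensor_one]
  map_star' S := by rw [← opTensor_star, star_one]

variable {H K}

theorem opTensorLeft_apply (S : H →L[ℂ] H) : opTensorLeft H K S = opTensor S 1 := rfl

theorem opTensorLeft_injective [Nontrivial K] : Function.Injective (opTensorLeft H K) := by
  refine (injective_iff_map_eq_zero _).2 fun S hS => ?_
  obtain ⟨k, hk⟩ := exists_ne (0 : K)
  ext h
  have h1 := toHilbertTensor_tmul_op S (1 : K →L[ℂ] K) h k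
  rw [← opTensorLeft_apply, hS] at h1
  have h2 : ‖S h ⊗ₜ[ℂ] k‖ = 0 := by
    rw [← toHilbertTensor.norm_map]
    exact (congrArg norm h1).symm.trans norm_zero
  rw [TensorProduct.norm_tmul, mul_eq_zero] at h2
  simpa [hk] using h2

instance [Nontrivial H] [Nontrivial K] : Nontrivial (HilbertTensor H K) := by
  obtain ⟨h, hh⟩ := exists_ne (0 : H)
  obtain ⟨k, hk⟩ := exists_ne (0 : K)
  refine ⟨toHilbertTensor (h ⊗ₜ k), 0, fun h0 => ?_⟩
  have h1 := congrArg norm h0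
  rw [toHilbertTensor.norm_map, TensorProduct.norm_tmul, norm_zero, mul_eq_zero] at h1
  simp [hh, hk] at h1

omit [CompleteSpace H] [CompleteSpace K] in
variable (H K) in
theorem dense_span_toHilbertTensor_tmul : Dense (Submodule.span ℂ
    {x : HilbertTensor H K | ∃ (h : H) (k : K), toHilbertTensor (h ⊗ₜ k) = x} :
      Set (HilbertTensor H K)) := by
  refine denseRange_toHilbertTensor.mono ?_
  rintro _ ⟨x, rfl⟩
  induction x using TensorProduct.induction_on with
  | zero => rw [map_zero]; exact zero_mem _
  | add x y hx hy => rw [map_add]; exact add_mem hx hy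
  | tmul h k => exact Submodule.subset_span ⟨h, k, rfl⟩

end OpTensorLeft

namespace ProductSystem

variable {P : Type u} [Monoid P] {E : ProductSystem P}
  {H : Type u} [NormedAddCommGroup H] [InnerProductSpace ℂ H] [CompleteSpace H]
  {K : Type u} [NormedAddCommGroup K] [InnerProductSpace ℂ K] [CompleteSpace K]

/-- From `φ(v)⋆φ(v) = ‖v‖² 1`. The bound depends on `v` alone, so arbitrary families of
representations have a direct sum. -/
theorem IsRepresentation.norm_le {φ : E.Total → (H →L[ℂ] H)} (hφ : E.IsRepresentation φ)
    (v : E.Total) : ‖φ v‖ ≤ ‖v.2‖ := by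
  have h : star (φ v) * φ v = (inner ℂ v.2 v.2 : ℂ) • (1 : H →L[ℂ] H) := hφ.star_mul v.1 v.2 v.2
  refine nonneg_le_nonneg_of_sq_le_sq (norm_nonneg _) ?_
  rw [← CStarRing.norm_star_mul_self, h, norm_smul, inner_self_eq_norm_sq_to_K]
  have h1 : ‖(1 : H →L[ℂ] H)‖ ≤ 1 := ContinuousLinearMap.norm_id_le
  simpa [sq] using mul_le_mul_of_nonneg_left h1 (mul_self_nonneg ‖v.2‖)

theorem IsRepresentation.star_mul_basis {φ : E.Total → (H →L[ℂ] H)} (hφ : E.IsRepresentation φ)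
    {s : P} {ι : Type*} [DecidableEq ι] (e : HilbertBasis ι ℂ (E.fiber s)) (i j : ι) :
    star (φ (E.incl s (e i))) * φ (E.incl s (e j)) = if i = j then 1 else 0 := by
  rw [hφ.star_mul, orthonormal_iff_ite.1 e.orthonormal]
  split_ifs <;> simp

theorem IsRepresentation.norm_sum_le {φ : E.Total → (H →L[ℂ] H)} (hφ : E.IsRepresentation φ)
    {s : P} {ι : Type*} (e : HilbertBasis ι ℂ (E.fiber s)) (F : Finset ι) (T : H →L[ℂ] H) :
    ‖∑ i ∈ F, φ (E.incl s (e i)) * T * star (φ (E.incl s (e i)))‖ ≤ ‖T‖ := by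
  classical
  exact norm_isometrySum_le (hφ.star_mul_basis e) F T

variable {A : Type u} [CStarAlgebra A] {β : P →* (A →⋆ₙₐ[ℂ] A)}

/-- It suffices to check covariance on a total set of vectors. -/
theorem IsCovariant.of_dense_span {π : A →⋆ₐ[ℂ] (H →L[ℂ] H)} {φ : E.Total → (H →L[ℂ] H)}
    (hφ : E.IsRepresentation φ) {S : Set H} (hS : Dense (Submodule.span ℂ S : Set H))
    (h : ∀ (s : P) (a : A) (ι : Type u) (e : HilbertBasis ι ℂ (E.fiber s)), ∀ x ∈ S,
      HasSum (fun i => (φ (E.incl s (e i)) * π a * star (φ (E.incl s (e i)))) x) (π (β s a) x)) :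
    E.IsCovariant β π φ where
  isRepresentation := hφ
  covariant s a ι e := hasSum_apply_of_dense_span (fun F => hφ.norm_sum_le e F (π a)) hS (h s a ι e)

/-- The tensor product of a covariant representation and a unitary representation of `P`. -/
theorem IsCovariant.tensor {π : A →⋆ₐ[ℂ] (H →L[ℂ] H)} {φ : E.Total → (H →L[ℂ] H)}
    (h : E.IsCovariant β π φ) (U : P →* unitary (K →L[ℂ] K)) :
    E.IsCovariant β ((opTensorLeft H K).comp π)
      (fun v => opTensor (φ v) (U (E.p v) : K →L[ℂ] K)) := by
  refine .of_dense_span ⟨fun x y => ?_, fun t u v => ?_⟩ (dense_span_toHilbertTensor_tmul H K) ?_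
  · rw [h.isRepresentation.map_mul, map_mul, map_mul, Submonoid.coe_mul, opTensor_mul]
  · rw [← opTensor_star, ← opTensor_mul, h.isRepresentation.star_mul]
    change opTensor _ (star (U t : K →L[ℂ] K) * (U t : K →L[ℂ] K)) = _
    rw [Unitary.coe_star_mul_self, opTensor_smul_left, opTensor_one]
  · rintro s a ι e _ ⟨x, k, rfl⟩
    -- All basis vectors lie over the same `s`, so each term carries `U_s` on the left and `U_s⋆` on
    -- the right of `1`, and these cancel.
    have h1 : ∀ i, opTensor (φ (E.incl s (e i))) (U s : K →L[ℂ] K) *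
        (opTensorLeft H K).comp π a *
        star (opTensor (φ (E.incl s (e i))) (U s : K →L[ℂ] K)) =
        opTensor (φ (E.incl s (e i)) * π a * star (φ (E.incl s (e i)))) 1 := by
      intro i
      change _ * opTensor (π a) 1 * _ = _
      rw [← opTensor_star, ← opTensor_mul, ← opTensor_mul, mul_one,
        Unitary.mul_star_self_of_mem (U s).2]
    -- Strong convergence at `x` is carried to `x ⊗ k` by the bounded map `x ↦ x ⊗ k`.
    have h2 := (h.covariant s a ι e x).mapL
      ((toHilbertTensor (H := H) (K := K)).toContinuousLinearMap ∘L
        (TensorProduct.mkL ℂ H K).flip k)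
    convert h2 using 1
    · funext i
      exact (congrArg (fun T => T (toHilbertTensor (x ⊗ₜ[ℂ] k))) (h1 i)).trans
        (toHilbertTensor_tmul_op _ _ _ _)
    · exact toHilbertTensor_tmul_op _ _ _ _

/-- Twisting a covariant representation by a character of `P`. -/
theorem IsCovariant.smul {π : A →⋆ₐ[ℂ] (H →L[ℂ] H)} {φ : E.Total → (H →L[ℂ] H)}
    (h : E.IsCovariant β π φ) (χ : P →* Circle) :
    E.IsCovariant β π (fun v => (χ (E.p v) : ℂ) • φ v) := by
  have h0 : ∀ t, star (χ t : ℂ) * (χ t : ℂ) = 1 := fun t => by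
    rw [Complex.star_def, Complex.conj_mul', Circle.norm_coe]; norm_num
  refine ⟨⟨fun x y => ?_, fun t u v => ?_⟩, fun s a ι e x => ?_⟩
  · rw [h.isRepresentation.map_mul, map_mul, map_mul, Circle.coe_mul, smul_mul_smul_comm]
  · rw [star_smul, smul_mul_smul_comm, h.isRepresentation.star_mul]
    change (star (χ t : ℂ) * (χ t : ℂ)) • _ = _
    rw [h0, one_smul]
  · convert h.covariant s a ι e x using 2 with i
    change ((χ s : ℂ) • φ (E.incl s (e i)) * π a * star ((χ s : ℂ) • φ (E.incl s (e i)))) x = _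
    rw [star_smul, smul_mul_assoc, smul_mul_smul_comm, mul_comm, h0, one_smul]

section DirectSum

variable {ι : Type u} {Hi : ι → Type u} [∀ i, NormedAddCommGroup (Hi i)]
  [∀ i, InnerProductSpace ℂ (Hi i)] [∀ i, CompleteSpace (Hi i)]

omit [∀ i, CompleteSpace (Hi i)] in
theorem dense_span_lp_single [DecidableEq ι] :
    Dense (Submodule.span ℂ {x : lp Hi 2 | ∃ i y, lp.single 2 i y = x} : Set (lp Hi 2)) := by
  intro x
  have h := lp.hasSum_single (p := 2) (by norm_num) x
  refine mem_closure_of_tendsto h (Filter.Eventually.of_forall fun F => ?_)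
  exact sum_mem fun i _ => Submodule.subset_span ⟨i, _, rfl⟩

/-- The direct sum of covariant representations is covariant. -/
theorem IsCovariant.directSum {π : ∀ i, A →⋆ₐ[ℂ] (Hi i →L[ℂ] Hi i)}
    {φ : ∀ i, E.Total → (Hi i →L[ℂ] Hi i)} (h : ∀ i, E.IsCovariant β (π i) (φ i)) :
    E.IsCovariant β (directSumRep π) (fun v => directSumOp (fun i => φ i v) (norm_nonneg v.2)
      fun i => (h i).isRepresentation.norm_le v) := by
  classical
  refine .of_dense_span ⟨fun x y => ?_, fun t u v => ?_⟩ dense_span_lp_single ?_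
  · refine directSumOp_ext fun z i => ?_
    rw [directSumOp_apply, (h i).isRepresentation.map_mul]
    rfl
  · rw [star_directSumOp]
    refine directSumOp_ext fun z i => ?_
    rw [mul_apply_eq_comp, directSumOp_apply, directSumOp_apply, ← mul_apply_eq_comp,
      (h i).isRepresentation.star_mul]
    rfl
  · rintro s a κ e _ ⟨i, y, rfl⟩
    have h2 := ((h i).covariant s a κ e y).mapL (lp.singleContinuousLinearMap ℂ Hi 2 i)
    convert h2 using 1
    · funext j
      rw [star_directSumOp, mul_apply_eq_comp, mul_apply_eq_comp, directSumOp_single,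
        directSumRep_single, directSumOp_single]
      rfl
    · exact directSumRep_single π _ i y

end DirectSum

end ProductSystem

/-! ### A criterion for coactions in terms of homogeneous generators -/

section Coaction

variable {G : Type u} [Group G]

variable (G) in
/-- The canonical unitaries of the group C⋆-algebra. -/
noncomputable def iGHom : G →* unitary (GroupCStar G) where
  toFun g := ⟨iG g, by
    rw [Unitary.mem_iff, star_iG, ← iG_mul, ← iG_mul, inv_mul_cancel, mul_inv_cancel, iG_one]
    exact ⟨rfl, rfl⟩⟩
  map_one' := Subtype.ext iG_one
  map_mul' g h := Subtype.ext (iG_mul g h)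

variable (G) in
/-- The trivial representation. -/
noncomputable def UnitaryRep.trivial : UnitaryRep G := ⟨EuclideanSpace ℂ PUnit.{u + 1}, 1⟩

instance : Nontrivial (UnitaryRep.trivial G).H :=
  inferInstanceAs (Nontrivial (EuclideanSpace ℂ PUnit.{u + 1}))

theorem UnitaryRep.toCStarRep_trivial_iG (g : G) :
    (UnitaryRep.trivial G).toCStarRep.π (iG g) = 1 := UnitaryRep.toCStarRep_iG _ g

instance : Nontrivial (GroupCStar G) := by
  have : Nontrivial (UnitaryRep.trivial G).toCStarRep.H :=
    inferInstanceAs (Nontrivial (UnitaryRep.trivial G).H)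
  exact (UnitaryRep.trivial G).toCStarRep.π.toRingHom.domain_nontrivial

variable {B : Type u} [CStarAlgebra B]

/-- The homogeneous elements of `B` with respect to `δ`. -/
def homogeneousSubmonoid (δ : B →⋆ₐ[ℂ] MinTensor B (GroupCStar G)) : Submonoid B where
  carrier := {b | ∃ g : G, δ b = tensor b (iG g)}
  one_mem' := ⟨1, by rw [map_one, iG_one, tensor_one]⟩
  mul_mem' := by
    rintro a b ⟨g, hg⟩ ⟨h, hh⟩
    exact ⟨g * h, by rw [map_mul, hg, hh, ← tensor_mul, iG_mul]⟩

theorem star_mem_homogeneousSubmonoid {δ : B →⋆ₐ[ℂ] MinTensor B (GroupCStar G)} {b : B}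
    (h : b ∈ homogeneousSubmonoid δ) : star b ∈ homogeneousSubmonoid δ := by
  obtain ⟨g, hg⟩ := h
  exact ⟨g⁻¹, by rw [map_star, hg, star_tensor, star_iG]⟩

/-- A closed subspace containing the homogeneous elements is everything, if `B` is generated by
homogeneous elements. -/
theorem mem_of_homogeneous_mem {δ : B →⋆ₐ[ℂ] MinTensor B (GroupCStar G)} {s : Set B}
    (hs : (StarAlgebra.adjoin ℂ s).topologicalClosure = ⊤)
    (hδ : s ⊆ homogeneousSubmonoid δ) {V : Submodule ℂ B} (hV : IsClosed (V : Set B))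
    (h : ∀ b ∈ homogeneousSubmonoid δ, b ∈ V) (b : B) : b ∈ V := by
  have h1 : b ∈ closure (StarAlgebra.adjoin ℂ s : Set B) := by
    rw [← StarSubalgebra.topologicalClosure_coe, hs]
    trivial
  refine closure_minimal (fun x hx => ?_) hV h1
  -- The generated ⋆-algebra is spanned by words in the generators and their adjoints, and such
  -- words are again homogeneous.
  have hx' : x ∈ Submodule.span ℂ (Submonoid.closure (s ∪ star s) : Set B) :=
    (StarAlgebra.adjoin_eq_span s).le hx
  refine Submodule.span_le.2 (fun y hy => h y ?_) hx'
  refine Submonoid.closure_le.2 (Set.union_subset hδ fun z hz => ?_) hy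
  exact star_star z ▸ star_mem_homogeneousSubmonoid (hδ hz)

/-- A ⋆-homomorphism for which `B` is generated by homogeneous elements is a coaction. -/
theorem isCoaction_of_homogeneous (hB : ∃ σ : CStarRep B, Function.Injective σ.π)
    {δ : B →⋆ₐ[ℂ] MinTensor B (GroupCStar G)} {s : Set B}
    (hs : (StarAlgebra.adjoin ℂ s).topologicalClosure = ⊤)
    (hδ : s ⊆ homogeneousSubmonoid δ) : IsCoaction δ where
  dense := by
    set S := Submodule.span ℂ {x | ∃ (b : B) (c : GroupCStar G), x = δ b * tensor 1 c}
    have hS : IsClosed (S.topologicalClosure : Set (MinTensor B (GroupCStar G))) :=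
      S.isClosed_topologicalClosure
    have h : ∀ b c, tensor b c ∈ S.topologicalClosure := by
      intro b c
      let L : B →ₗ[ℂ] MinTensor B (GroupCStar G) :=
        (LinearMap.mulRight ℂ (tensor 1 c)).comp (tensorLeft B (GroupCStar G)).toAlgHom.toLinearMap
      have hL : ∀ b, L b = tensor b c := fun b => (tensor_eq_mul b c).symm
      rw [← hL]
      refine mem_of_homogeneous_mem hs hδ (V := S.topologicalClosure.comap L) ?_ ?_ b
      · exact hS.preimage ((continuous_tensor_left c).congr fun b => (hL b).symm)
      · rintro b ⟨g, hg⟩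
        rw [Submodule.mem_comap, hL]
        -- For `b` of degree `g`, `δ(b)(1 ⊗ i_G(g⁻¹) c) = (b ⊗ i_G(g))(1 ⊗ i_G(g⁻¹) c) = b ⊗ c`.
        refine S.le_topologicalClosure (Submodule.subset_span ⟨b, iG g⁻¹ * c, ?_⟩)
        rw [hg, ← tensor_mul, ← mul_assoc, ← iG_mul, mul_inv_cancel, iG_one, one_mul, mul_one]
    intro x
    exact mem_of_tensor_mem hS h x
  coassoc := by
    obtain ⟨α, hα⟩ := exists_minTensorAssoc hB (GroupCStar.exists_injective_rep G)
      (GroupCStar.exists_injective_rep G)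
    refine ⟨α, hα, fun b => ?_⟩
    have h : (α.toStarAlgHom.comp (minTensorMap δ (StarAlgHom.id ℂ _))).comp δ =
        (minTensorMap (StarAlgHom.id ℂ B) (comul G)).comp δ := by
      -- On a generator of degree `g` both sides equal `b ⊗ (i_G(g) ⊗ i_G(g))`.
      refine StarAlgHom.ext_of_topologicalClosure_adjoin_eq_top hs fun b hb => ?_
      obtain ⟨g, hg⟩ := hδ hb
      change α (minTensorMap δ (StarAlgHom.id ℂ _) (δ b)) =
        minTensorMap (StarAlgHom.id ℂ B) (comul G) (δ b)
      rw [hg, minTensorMap_tensor, minTensorMap_tensor, hg]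
      change α (tensor (tensor b (iG g)) (iG g)) = tensor b (comul G (iG g))
      rw [hα, comul_iG]
    exact DFunLike.congr_fun h b

end Coaction

/-! ### The coaction and the dual action on a crossed product -/

namespace ProductSystem.IsCrossedProduct

variable {P : Type u} [Monoid P] {E : ProductSystem P} {A : Type u} [CStarAlgebra A]
  {β : P →* (A →⋆ₙₐ[ℂ] A)} {B : Type u} [CStarAlgebra B] {iA : A →⋆ₐ[ℂ] B} {iE : E.Total → B}

theorem topologicalClosure_adjoin (hX : E.IsCrossedProduct β iA iE) :
    (StarAlgebra.adjoin ℂ (Set.range (Sum.elim iA iE))).topologicalClosure = ⊤ := by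
  rw [Set.Sum.elim_range]
  exact hX.generates

theorem exists_injective_rep (hX : E.IsCrossedProduct β iA iE) :
    ∃ σ : CStarRep B, Nontrivial σ.H ∧ Function.Injective σ.π ∧
      E.IsCovariant β (σ.π.comp iA) (σ.π ∘ iE) := by
  obtain ⟨H, _, _, _, _, σ, hσ, hcov⟩ := hX.exists_faithful
  exact ⟨⟨H, σ⟩, inferInstance, hσ, hcov⟩

theorem hom_ext (hX : E.IsCrossedProduct β iA iE) {D : Type*} [CStarAlgebra D] {f g : B →⋆ₐ[ℂ] D}
    (hA : ∀ a, f (iA a) = g (iA a)) (hE : ∀ v, f (iE v) = g (iE v)) : f = g := by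
  refine StarAlgHom.ext_of_topologicalClosure_adjoin_eq_top hX.topologicalClosure_adjoin ?_
  rintro _ ⟨a | v, rfl⟩
  · exact hA a
  · exact hE v

/-- The canonical coaction on a crossed product. -/
theorem exists_coaction {G : Type u} [Group G] (hX : E.IsCrossedProduct β iA iE) (q : P →* G) :
    ∃ δ : B →⋆ₐ[ℂ] MinTensor B (GroupCStar G), Function.Injective δ ∧ IsCoaction δ ∧
      (∀ a : A, δ (iA a) = tensor (iA a) 1) ∧
      ∀ v : E.Total, δ (iE v) = tensor (iE v) (iG (q (E.p v))) := by
  obtain ⟨σ, hH, hσ, hcov⟩ := hX.exists_injective_rep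
  obtain ⟨ω, hω⟩ := GroupCStar.exists_injective_rep G
  -- The universal property concerns nonzero Hilbert spaces only, so `σ.H ⊗ ω.H` must be nonzero;
  -- this holds because `C*(G)` is nonzero and `ω` is faithful.
  have hK : Nontrivial ω.H := by
    by_contra hK
    rw [not_nontrivial_iff_subsingleton] at hK
    have h : ω.π 1 = ω.π 0 := by
      ext x
      exact Subsingleton.elim _ _
    exact one_ne_zero (hω h)
  let U : P →* unitary (ω.H →L[ℂ] ω.H) := (mapUnitary ω.π (iGHom G)).comp q
  obtain ⟨ρ, hρA, hρE⟩ := hX.exists_lift _ _ _ (hcov.tensor U)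
  -- `ρ` sends each generator to the image under `σ ⊗ ω` of the element prescribed for `δ`, so `ρ`
  -- factors through the faithful `σ ⊗ ω`.
  obtain ⟨δ, hδ, -⟩ := StarAlgHom.exists_lift_of_injective hX.topologicalClosure_adjoin
    (minTensorRep_injective hσ hω) (ρ := ρ)
    (f := Sum.elim (fun a => tensor (iA a) 1) fun v => tensor (iE v) (iG (q (E.p v)))) (by
      rintro (a | v)
      · refine (DFunLike.congr_fun hρA a).trans ?_
        rw [Sum.elim_inl, minTensorRep_tensor, map_one]
        rfl
      · refine (congrFun hρE v).trans ?_
        rw [Sum.elim_inr, minTensorRep_tensor]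
        rfl)
  have hδA : ∀ a : A, δ (iA a) = tensor (iA a) 1 := fun a => hδ (Sum.inl a)
  have hδE : ∀ v : E.Total, δ (iE v) = tensor (iE v) (iG (q (E.p v))) := fun v => hδ (Sum.inr v)
  refine ⟨δ, ?_, ?_, hδA, hδE⟩
  · let τ := (UnitaryRep.trivial G).toCStarRep
    have : Nontrivial τ.H := inferInstanceAs (Nontrivial (UnitaryRep.trivial G).H)
    have h : (minTensorRep σ τ).comp δ = (opTensorLeft σ.H τ.H).comp σ.π := by
      refine hX.hom_ext (fun a => ?_) fun v => ?_
      · change minTensorRep σ τ (δ _) = _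
        rw [hδA, minTensorRep_tensor, map_one]
        rfl
      · change minTensorRep σ τ (δ _) = _
        rw [hδE, minTensorRep_tensor, UnitaryRep.toCStarRep_trivial_iG]
        rfl
    have h1 : Function.Injective ((minTensorRep σ τ).comp δ) := by
      rw [h]
      exact opTensorLeft_injective.comp hσ
    exact Function.Injective.of_comp (f := minTensorRep σ τ) h1
  · refine isCoaction_of_homogeneous ⟨σ, hσ⟩ hX.topologicalClosure_adjoin ?_
    rintro _ ⟨a | v, rfl⟩
    · exact ⟨1, by rw [Sum.elim_inl, hδA, iG_one]⟩
    · exact ⟨_, hδE v⟩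

/-- The gauge endomorphism of a crossed product defined by a character. -/
theorem exists_gauge (hX : E.IsCrossedProduct β iA iE) (χ : P →* Circle) :
    ∃ α : B →⋆ₐ[ℂ] B, (∀ a, α (iA a) = iA a) ∧ ∀ v, α (iE v) = (χ (E.p v) : ℂ) • iE v := by
  obtain ⟨σ, hH, hσ, hcov⟩ := hX.exists_injective_rep
  obtain ⟨ρ, hρA, hρE⟩ := hX.exists_lift _ _ _ (hcov.smul χ)
  -- The twisted pair maps generators into the image of `σ` itself, so `ρ` factors through `σ` as `σ
  -- ∘ α`.
  obtain ⟨α, hα, -⟩ := StarAlgHom.exists_lift_of_injective hX.topologicalClosure_adjoin hσ (ρ := ρ)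
    (f := Sum.elim iA fun v => (χ (E.p v) : ℂ) • iE v) (by
      rintro (a | v)
      · exact DFunLike.congr_fun hρA a
      · refine (congrFun hρE v).trans ?_
        rw [Sum.elim_inr, map_smul]
        rfl)
  exact ⟨α, fun a => hα (Sum.inl a), fun v => hα (Sum.inr v)⟩

/-- The dual action on a crossed product. -/
theorem exists_dualAction {G : Type u} [Group G] [TopologicalSpace G]
    (hX : E.IsCrossedProduct β iA iE) (q : P →* G) :
    ∃ βhat : PontryaginDual G →* (B ≃⋆ₐ[ℂ] B),
      (∀ b : B, Continuous fun γ => βhat γ b) ∧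
      (∀ (γ : PontryaginDual G) (a : A), βhat γ (iA a) = iA a) ∧
      ∀ (γ : PontryaginDual G) (v : E.Total),
        βhat γ (iE v) = (γ (q (E.p v)) : ℂ) • iE v := by
  choose α hαA hαE using fun γ : PontryaginDual G =>
    hX.exists_gauge ((γ : G →* Circle).comp q)
  have hone : α 1 = StarAlgHom.id ℂ B := by
    refine hX.hom_ext (fun a => hαA 1 a) fun v => (hαE 1 v).trans ?_
    exact one_smul ℂ (iE v)
  have hmul : ∀ γ γ', α (γ * γ') = (α γ).comp (α γ') := by
    intro γ γ'
    refine hX.hom_ext (fun a => ?_) fun v => ?_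
    · rw [StarAlgHom.comp_apply, hαA, hαA, hαA]
    · rw [StarAlgHom.comp_apply, hαE, hαE, map_smul, hαE, smul_smul, mul_comm]
      rfl
  let βhat : PontryaginDual G →* (B ≃⋆ₐ[ℂ] B) :=
    { toFun := fun γ => StarAlgEquiv.ofStarAlgHom (α γ) (α γ⁻¹)
        (by rw [← hmul, inv_mul_cancel, hone]) (by rw [← hmul, mul_inv_cancel, hone])
      map_one' := StarAlgEquiv.ext fun b => DFunLike.congr_fun hone b
      map_mul' := fun γ γ' => StarAlgEquiv.ext fun b => DFunLike.congr_fun (hmul γ γ') b }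
  refine ⟨βhat, fun b => ?_, hαA, hαE⟩
  -- The elements with norm continuous orbit form a closed ⋆-subalgebra, so only generators need to
  -- be examined.
  let S : StarSubalgebra ℂ B :=
    { carrier := {b | Continuous fun γ => α γ b}
      mul_mem' := fun {a b} ha hb =>
        (Continuous.mul ha hb).congr fun γ => (map_mul (α γ) a b).symm
      add_mem' := fun {a b} ha hb =>
        (Continuous.add ha hb).congr fun γ => (map_add (α γ) a b).symm
      algebraMap_mem' := fun c =>
        continuous_const.congr fun γ => (AlgHomClass.commutes (α γ) c).symm
      star_mem' := fun {a} ha =>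
        (Continuous.star ha).congr fun γ => (map_star (α γ) a).symm }
  have hS : IsClosed (S : Set B) := by
    refine isClosed_of_closure_subset fun b hb => ?_
    -- Each `α γ` is contractive, so approximating `b` by `c` approximates the orbit map uniformly
    -- in `γ`.
    refine continuous_of_uniform_approx_of_continuous fun u hu => ?_
    obtain ⟨ε, hε, hεu⟩ := Metric.mem_uniformity_dist.1 hu
    obtain ⟨c, hc, hbc⟩ := Metric.mem_closure_iff.1 hb ε hε
    refine ⟨fun γ => α γ c, hc, fun γ => hεu ?_⟩
    rw [dist_eq_norm, ← map_sub]
    exact (NonUnitalStarAlgHom.norm_apply_le (α γ) _).trans_lt (by rwa [← dist_eq_norm])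
  refine StarAlgHom.mem_of_topologicalClosure_adjoin_eq_top hX.topologicalClosure_adjoin hS ?_ b
  rintro _ ⟨a | v, rfl⟩
  · change Continuous fun γ => α γ (iA a)
    simp only [hαA]
    exact continuous_const
  · change Continuous fun γ => α γ (iE v)
    simp only [hαE]
    -- The dual group carries the compact-open topology, for which evaluation at a point is
    -- continuous.
    have h : Continuous fun γ : PontryaginDual G => γ (q (E.p v)) :=
      (continuous_eval_const (F := C(G, Circle)) (q (E.p v))).comp
        (ContinuousMonoidHom.isInducing_toContinuousMap G Circle).continuous
    exact (continuous_subtype_val.comp h).smul continuous_const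

end ProductSystem.IsCrossedProduct

/-! ### Existence of the crossed product -/

section StarPolynomials

variable {ι : Type*} {X Y : Type*} [CStarAlgebra X] [CStarAlgebra Y]

/-- The evaluation of ⋆-polynomials at a family of elements; the second copy of the variables
stands for their adjoints. -/
noncomputable def starEval (g : ι → X) : FreeAlgebra ℂ (ι ⊕ ι) →ₐ[ℂ] X :=
  FreeAlgebra.lift ℂ (Sum.elim g fun i => star (g i))

theorem starEval_ι (g : ι → X) (i : ι ⊕ ι) :
    starEval g (FreeAlgebra.ι ℂ i) = Sum.elim g (fun i => star (g i)) i :=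
  FreeAlgebra.lift_ι_apply _ _

theorem starEval_map (f : X →⋆ₐ[ℂ] Y) (g : ι → X) (r : FreeAlgebra ℂ (ι ⊕ ι)) :
    f (starEval g r) = starEval (fun i => f (g i)) r := by
  have h : f.toAlgHom.comp (starEval g) = starEval fun i => f (g i) := by
    refine FreeAlgebra.hom_ext (funext ?_)
    rintro (i | i)
    · change f (starEval g (FreeAlgebra.ι ℂ _)) = starEval _ (FreeAlgebra.ι ℂ _)
      rw [starEval_ι, starEval_ι]
      rfl
    · change f (starEval g (FreeAlgebra.ι ℂ _)) = starEval _ (FreeAlgebra.ι ℂ _)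
      rw [starEval_ι, starEval_ι]
      exact map_star f (g i)
  exact DFunLike.congr_fun h r

theorem exists_starEval_eq (g : ι → X) {x : X} (hx : x ∈ StarAlgebra.adjoin ℂ (Set.range g)) :
    ∃ r, starEval g r = x := by
  have h : Algebra.adjoin ℂ (Set.range g ∪ star (Set.range g)) ≤ (starEval g).range := by
    refine Algebra.adjoin_le (Set.union_subset ?_ ?_)
    · rintro _ ⟨i, rfl⟩
      exact ⟨FreeAlgebra.ι ℂ (Sum.inl i), starEval_ι g _⟩
    · rintro y ⟨i, hi⟩
      exact ⟨FreeAlgebra.ι ℂ (Sum.inr i), (starEval_ι g _).trans (star_eq_iff_star_eq.1 hi.symm)⟩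
  exact h ((StarAlgebra.adjoin_toSubalgebra ℂ (Set.range g)).le hx)

end StarPolynomials

section DirectSum

variable {κ : Type*} {H : κ → Type*} [∀ k, NormedAddCommGroup (H k)]
  [∀ k, InnerProductSpace ℂ (H k)] [∀ k, CompleteSpace (H k)] {ι : Type*}

theorem starEval_apply_coe {g : ι → lp H 2 →L[ℂ] lp H 2} {f : ∀ k, ι → H k →L[ℂ] H k}
    (h : ∀ i x k, g i x k = f k i (x k)) (h' : ∀ i x k, star (g i) x k = star (f k i) (x k))
    (r : FreeAlgebra ℂ (ι ⊕ ι)) (x : lp H 2) (k : κ) :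
    starEval g r x k = starEval (f k) r (x k) := by
  induction r using FreeAlgebra.induction generalizing x with
  | grade0 c =>
    rw [AlgHomClass.commutes, AlgHomClass.commutes, Algebra.algebraMap_eq_smul_one,
      Algebra.algebraMap_eq_smul_one]
    rfl
  | grade1 i =>
    rw [starEval_ι, starEval_ι]
    rcases i with i | i
    · exact h i x k
    · exact h' i x k
  | mul a b ha hb => rw [map_mul, map_mul, mul_apply_eq_comp, mul_apply_eq_comp, ha, hb]
  | add a b ha hb => rw [map_add, map_add, add_apply, add_apply, lp.coeFn_add, Pi.add_apply, ha, hb]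

/-- Operators acting coordinatewise are tested on vectors supported at `k`, and passing to a single
coordinate does not increase the norm. -/
theorem norm_starEval_le {g : ι → lp H 2 →L[ℂ] lp H 2} {f : ∀ k, ι → H k →L[ℂ] H k}
    (h : ∀ i x k, g i x k = f k i (x k)) (h' : ∀ i x k, star (g i) x k = star (f k i) (x k))
    (r : FreeAlgebra ℂ (ι ⊕ ι)) (k : κ) : ‖starEval (f k) r‖ ≤ ‖starEval g r‖ := by
  classical
  refine ContinuousLinearMap.opNorm_le_bound _ (norm_nonneg _) fun y => ?_
  have h1 := starEval_apply_coe h h' r (lp.single 2 k y) k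
  rw [lp.single_apply_self] at h1
  rw [← h1]
  refine (lp.norm_apply_le_norm (by norm_num) _ k).trans (((starEval g r).le_opNorm _).trans_eq ?_)
  rw [lp.norm_single (by norm_num)]

end DirectSum

section Generated

variable {X : Type*} [CStarAlgebra X] {ι : Type*}

/-- The C⋆-subalgebra generated by a family. -/
noncomputable abbrev cstarGenerated (g : ι → X) : StarSubalgebra ℂ X :=
  (StarAlgebra.adjoin ℂ (Set.range g)).topologicalClosure

noncomputable instance (g : ι → X) : CStarAlgebra (cstarGenerated g) :=
  have : IsClosed (cstarGenerated g : Set X) := StarSubalgebra.isClosed_topologicalClosure _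
  inferInstance

theorem mem_cstarGenerated (g : ι → X) (i : ι) : g i ∈ cstarGenerated g :=
  StarSubalgebra.le_topologicalClosure _ (StarAlgebra.subset_adjoin _ _ ⟨i, rfl⟩)

theorem topologicalClosure_adjoin_cstarGenerated (g : ι → X) :
    (StarAlgebra.adjoin ℂ (Set.range fun i =>
      (⟨g i, mem_cstarGenerated g i⟩ : cstarGenerated g))).topologicalClosure = ⊤ := by
  refine StarSubalgebra.eq_top_iff.2 fun x => ?_
  change x ∈ closure _
  rw [closure_subtype]
  have h : StarSubalgebra.map (cstarGenerated g).subtype (StarAlgebra.adjoin ℂ (Set.range fun i =>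
      (⟨g i, mem_cstarGenerated g i⟩ : cstarGenerated g))) =
      StarAlgebra.adjoin ℂ (Set.range g) := by
    rw [StarAlgHom.map_adjoin, ← Set.range_comp]
    rfl
  have h1 : (x : X) ∈ closure (StarAlgebra.adjoin ℂ (Set.range g) : Set X) := x.2
  rwa [← h] at h1

end Generated

namespace ProductSystem

variable {P : Type u} [Monoid P] (E : ProductSystem P) {A : Type u} [CStarAlgebra A]
  (β : P →* (A →⋆ₙₐ[ℂ] A))

/-- A covariant representation on a nonzero Hilbert space. -/
structure CovariantRep where
  H : Type u
  [normedAddCommGroup : NormedAddCommGroup H]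
  [innerProductSpace : InnerProductSpace ℂ H]
  [completeSpace : CompleteSpace H]
  [nontrivial : Nontrivial H]
  π : A →⋆ₐ[ℂ] (H →L[ℂ] H)
  φ : E.Total → (H →L[ℂ] H)
  isCovariant : E.IsCovariant β π φ

attribute [instance] CovariantRep.normedAddCommGroup CovariantRep.innerProductSpace
  CovariantRep.completeSpace CovariantRep.nontrivial

variable {E β}

/-- The joint map of generators defined by a covariant representation. -/
noncomputable def CovariantRep.gen (k : CovariantRep E β) : A ⊕ E.Total → (k.H →L[ℂ] k.H) :=
  Sum.elim k.π k.φ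

/-- The algebra is the one generated by the images of `π₀` and `Φ`, on which the inclusion is a
faithful covariant representation. The domination `hle` is exactly the norm criterion for extending
any other covariant pair from the generators. -/
theorem IsCovariant.exists_isCrossedProduct {K : Type u} [NormedAddCommGroup K]
    [InnerProductSpace ℂ K] [CompleteSpace K] [Nontrivial K] {π₀ : A →⋆ₐ[ℂ] (K →L[ℂ] K)}
    {Φ : E.Total → (K →L[ℂ] K)} (hπΦ : E.IsCovariant β π₀ Φ)
    (hle : ∀ (k : CovariantRep E β) r, ‖starEval k.gen r‖ ≤ ‖starEval (Sum.elim π₀ Φ) r‖) :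
    ∃ (B : Type u) (_ : CStarAlgebra B) (iA : A →⋆ₐ[ℂ] B) (iE : E.Total → B),
      E.IsCrossedProduct β iA iE := by
  obtain ⟨g, hg⟩ : ∃ g : A ⊕ E.Total → (K →L[ℂ] K), g = Sum.elim π₀ Φ := ⟨_, rfl⟩
  rw [← hg] at hle
  have hgA : ∀ a, g (Sum.inl a) = π₀ a := fun a => congrFun hg _
  have hgE : ∀ v, g (Sum.inr v) = Φ v := fun v => congrFun hg _
  let iA : A →⋆ₐ[ℂ] cstarGenerated g :=
    π₀.codRestrict _ fun a => hgA a ▸ mem_cstarGenerated g (Sum.inl a)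
  let iE : E.Total → cstarGenerated g :=
    fun v => ⟨Φ v, hgE v ▸ mem_cstarGenerated g (Sum.inr v)⟩
  have hi : Sum.elim iA iE = fun i => ⟨g i, mem_cstarGenerated g i⟩ := by
    funext i
    rcases i with a | v
    · exact Subtype.ext (hgA a).symm
    · exact Subtype.ext (hgE v).symm
  have hgen : (StarAlgebra.adjoin ℂ (Set.range (Sum.elim iA iE))).topologicalClosure = ⊤ := by
    rw [hi]
    exact topologicalClosure_adjoin_cstarGenerated g
  refine ⟨cstarGenerated g, inferInstance, iA, iE, ?_, ?_, ?_⟩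
  · exact ⟨K, _, _, inferInstance, inferInstance, (cstarGenerated g).subtype,
      Subtype.val_injective, hπΦ⟩
  · intro H _ _ _ _ π φ h
    obtain ⟨ρ, hρ⟩ := StarAlgHom.exists_lift_of_norm_le (f := Sum.elim π φ) hgen fun s hs => by
      obtain ⟨r, rfl⟩ := exists_starEval_eq _ hs
      have h1 : (starEval (fun i => (Sum.elim iA iE i, Sum.elim π φ i)) r).1 =
          starEval (Sum.elim iA iE) r :=
        starEval_map (StarAlgHom.fst ℂ (cstarGenerated g) (H →L[ℂ] H)) _ r
      have h2 : (starEval (fun i => (Sum.elim iA iE i, Sum.elim π φ i)) r).2 =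
          starEval (Sum.elim π φ) r :=
        starEval_map (StarAlgHom.snd ℂ (cstarGenerated g) (H →L[ℂ] H)) _ r
      have h3 : (cstarGenerated g).subtype (starEval (Sum.elim iA iE) r) = starEval g r := by
        rw [starEval_map, hi]
        rfl
      rw [h1, h2]
      refine (hle ⟨H, π, φ, h⟩ r).trans_eq ?_
      rw [← h3]
      rfl
    exact ⟨ρ, StarAlgHom.ext fun a => hρ (Sum.inl a), funext fun v => hρ (Sum.inr v)⟩
  · rw [← Set.Sum.elim_range]
    exact hgen

theorem exists_isCrossedProduct (hcov : E.HasCovariantRep β) :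
    ∃ (B : Type u) (_ : CStarAlgebra B) (iA : A →⋆ₐ[ℂ] B) (iE : E.Total → B),
      E.IsCrossedProduct β iA iE := by
  -- Covariant representations live one universe too high to be summed over. What matters is only
  -- the function recording the norms of all ⋆-polynomials, and these functions form a type in
  -- universe `u`; `c` picks one representation for each.
  let N : CovariantRep E β → FreeAlgebra ℂ ((A ⊕ E.Total) ⊕ (A ⊕ E.Total)) → ℝ :=
    fun k r => ‖starEval k.gen r‖
  let c : Set.range N → CovariantRep E β := fun j => j.2.choose
  have hc : ∀ k : CovariantRep E β, ∃ j, ∀ r, ‖starEval (c j).gen r‖ = ‖starEval k.gen r‖ :=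
    fun k => ⟨⟨N k, k, rfl⟩, fun r => congrFun (Set.mem_range_self (f := N) k).choose_spec r⟩
  have hπΦ := IsCovariant.directSum fun j => (c j).isCovariant
  -- The direct sum is nonzero because at least one covariant representation exists, so at least one
  -- norm function occurs.
  have : Nontrivial (lp (fun j => (c j).H) 2) := by
    classical
    obtain ⟨H, _, _, _, _, π, φ, h⟩ := hcov
    obtain ⟨j, -⟩ := hc ⟨H, π, φ, h⟩
    obtain ⟨y, hy⟩ := exists_ne (0 : (c j).H)
    refine ⟨lp.single 2 j y, 0, fun h0 => hy ?_⟩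
    rw [← lp.single_apply_self (E := fun j => (c j).H) 2 j y, h0]
    rfl
  refine hπΦ.exists_isCrossedProduct fun k r => ?_
  obtain ⟨j, hj⟩ := hc k
  rw [← hj r]
  refine norm_starEval_le (f := fun j => (c j).gen) ?_ ?_ r j
  · rintro (a | v) x k <;> rfl
  · rintro (a | v) x k
    · rw [Sum.elim_inl, ← map_star]
      change (c k).π (star a) (x k) = star ((c k).π a) (x k)
      rw [← map_star]
    · rw [Sum.elim_inr, star_directSumOp]
      rfl

end ProductSystem

theorem mainTheorem6 {G : Type u} [Group G] [TopologicalSpace G] [DiscreteTopology G]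
    (P : Submonoid G) {A : Type u} [CStarAlgebra A] (β : P →* (A →⋆ₙₐ[ℂ] A))
    (E : ProductSystem P) (hcov : E.HasCovariantRep β) :
    (∃ (B : Type u) (_ : CStarAlgebra B) (iA : A →⋆ₐ[ℂ] B) (iE : E.Total → B),
      E.IsCrossedProduct β iA iE) ∧
    ∀ (B : Type u) [CStarAlgebra B] (iA : A →⋆ₐ[ℂ] B) (iE : E.Total → B),
      E.IsCrossedProduct β iA iE →
      (∃ δ : B →⋆ₐ[ℂ] MinTensor B (GroupCStar G),
        Function.Injective δ ∧ IsCoaction δ ∧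
        (∀ a : A, δ (iA a) = tensor (iA a) 1) ∧
        ∀ v : E.Total, δ (iE v) = tensor (iE v) (iG (E.p v : G))) ∧
      ((∀ x y : G, x * y = y * x) →
        ∃ βhat : PontryaginDual G →* (B ≃⋆ₐ[ℂ] B),
          (∀ b : B, Continuous fun γ => βhat γ b) ∧
          (∀ (γ : PontryaginDual G) (a : A), βhat γ (iA a) = iA a) ∧
          ∀ (γ : PontryaginDual G) (v : E.Total),
            βhat γ (iE v) = (γ (E.p v : G) : ℂ) • iE v) := by
  refine ⟨ProductSystem.exists_isCrossedProduct hcov, fun B _ iA iE hX => ⟨?_, fun _ => ?_⟩⟩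
  · exact hX.exists_coaction P.subtype
  · exact hX.exists_dualAction P.subtype
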